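/- All graphs are finite, simple and undirected, $\log$ is the binary logarithm, and a clique is a non-empty set of pairwise adjacent vertices. **Mixed labelling schemes.** Let $\mathcal{G}$ be a class of graphs and $g_1,g_2,g_3:\mathbb{N}\to\mathbb{R}^+$, where $\mathbb{R}^+$ is the set of positive reals. The class $\mathcal{G}$ admits a *weighted $(g_1,g_2,g_3)$ mixed labelling scheme* if there are functions $A:(\{0,1\}^*)^2\to\{0,1\}$ and $I:(\{0,1\}^*)^3\to\{0,1\}$ such that for every $n\ge 1$, every $n$-vertex graph $G^+\in\mathcal{G}$, every spanning subgraph $G$ of $G^+$ and every $\omega:V(G)\to\mathbb{R}^+$, with $\omega(G):=\sum_{v\in V(G)}\omega(v)$, there are an injective function $\mu$ from the disjoint union of $V(G)$ and the set of cliques of $G^+$ to $\{0,1\}^*$, and strings $\kappa(K,u)\in\{0,1\}^*$ for all cliques $K$ of $G^+$ and all $u\in K$, such that 1. for all $u,v\in V(G)$: $A(\mu(u),\mu(v))=1$ if and only if $uv\in E(G)$; 2. for every clique $K$ of $G^+$, $u\in K$ and $v\in V(G)$: $I(\mu(K),\kappa(K,u),\mu(v))=1$ if and only if $u=v$; 3.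 $|\mu(v)|\le\log\omega(G)-\log\omega(v)+g_1(n)$ for every $v\in V(G)$; 4. $|\mu(K)|\le\log\omega(G)-\log\min_{v\in K}\omega(v)+g_3(n)$ for every clique $K$ of $G^+$; 5. $|\kappa(K,u)|\le g_2(n)$ for every clique $K$ of $G^+$ and every $u\in K$. The class admits an *efficient* weighted mixed labelling scheme if this holds for some $g_1,g_2,g_3:\mathbb{N}\to\mathbb{R}^+$ with $g_1,g_2,g_3\in o(\log n)$. **Tree-decompositions.** A *tree-decomposition* of a graph $G$ is a finite tree $T$ with bags $B_x\subseteq V(G)$ $(x\in V(T))$ such that for every $v\in V(G)$ the set $\{x: v\in B_x\}$ is non-empty and induces a connected subgraph of $T$, and every edge of $G$ has both ends in a common bag. Its *adhesion-width* is the maximum of $|B_x\cap B_y|$ over distinct $x,y\in V(T)$ ($0$ if $T$ has one node). The *torso* of $x$ is the graph on $B_x$ in which distinct $u,v$ are adjacent if $uv\in E(G)$ or $u,v\in B_x\cap B_y$ for some neighbour $y$ of $x$ in $T$. For a class $\mathcal{G}$ and $k\in\mathbb{N}$ let $\mathcal{G}'_k$ be the class of all graphs that have a tree-decomposition of adhesion-width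 at most $k$ all of whose torsos are in $\mathcal{G}$. A class is *hereditary* if it contains (up to isomorphism) every induced subgraph of each of its members. **Theorem.** (a) Let $\mathcal{G}$ be a hereditary class of graphs that admits an efficient weighted mixed labelling scheme. Then for every $k\in\mathbb{N}$ the class $\mathcal{G}'_k$ admits an efficient weighted mixed labelling scheme. (b) Let $\mathcal{G}$ be a hereditary class of graphs closed under taking disjoint unions, let $k\in\mathbb{N}$, and let $g_1,g_2,g_3:\mathbb{N}\to\mathbb{R}^+$ be non-decreasing functions with $g_1,g_2,g_3\in O(\log n)$. If $\mathcal{G}$ admits a weighted $(g_1,g_2,g_3)$ mixed labelling scheme, then $\mathcal{G}'_k$ admits a weighted $(g_1'',g_2'',g_3'')$ mixed labelling scheme for some $g_1'',g_2'',g_3'':\mathbb{N}\to\mathbb{R}^+$ with $$g_1''(n)=g_1(n)+O(g_2(n))+O\left(\sqrt{g_3(n)\log n}\right)+O\left(\sqrt{\frac{\log n}{g_3(n)}}\,\log\log n\right),$$ $$g_2''(n)=g_2(n)+O\left(\sqrt{g_3(n)\log n}\right)+O(\log\log n),$$ $$g_3''(n)=O\left(\sqrt{g_3(n)\log n}\right)+O\left(\sqrt{\frac{\log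 n}{g_3(n)}}\,\log\log n\right)$$ as $n\to\infty$. The implied constants may depend on $\mathcal{G}$, $k$ and $g_1,g_2,g_3$. -/

import Mathlib

open Filter Asymptotics

/-- A class of finite simple graphs. (Vertex types in `Type` cover every finite graph up to
isomorphism.) -/
abbrev GraphClass : Type 1 := ∀ (V : Type) [Finite V], SimpleGraph V → Prop

/-- A class is hereditary if it contains every induced subgraph of each of its members. Induced
subgraphs are taken up to isomorphism, so a hereditary class is closed under isomorphism. -/
def GraphClass.Hereditary (𝒢 : GraphClass) : Prop :=
  ∀ (V W : Type) [Finite V] [Finite W] (G : SimpleGraph V) (H : SimpleGraph W),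
    𝒢 V G → Nonempty (H ↪g G) → 𝒢 W H

/-- A class is closed under (vertex-)disjoint union. -/
def GraphClass.ClosedUnderDisjointUnion (𝒢 : GraphClass) : Prop :=
  ∀ (V W : Type) [Finite V] [Finite W] (G : SimpleGraph V) (H : SimpleGraph W),
    𝒢 V G → 𝒢 W H → 𝒢 (V ⊕ W) (G.sum H)

/-- The cliques of a graph: non-empty sets of pairwise adjacent vertices. -/
def CliqueOf {V : Type} (G : SimpleGraph V) : Type :=
  {K : Finset V // K.Nonempty ∧ G.IsClique (K : Set V)}

/-- `(μ, κ)` is a weighted `(g₁, g₂, g₃)` mixed labelling of `(Gp, G, ω)` for the testers `(A, I)`.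
The label `μ` is defined on the disjoint union of the vertex set and the set of cliques of `Gp`;
only the values `κ K u` with `u ∈ K` matter. The bounds `b₁ b₂ b₃` are the values `gᵢ(n)`. -/
structure IsWeightedMixedLabelling {V : Type} [Fintype V]
    (A : List Bool → List Bool → Bool) (I : List Bool → List Bool → List Bool → Bool)
    (b₁ b₂ b₃ : ℝ) (Gp G : SimpleGraph V) (ω : V → ℝ)
    (μ : V ⊕ CliqueOf Gp → List Bool) (κ : CliqueOf Gp → V → List Bool) : Prop where
  injective : Function.Injective μ
  adjacency : ∀ u v : V, A (μ (Sum.inl u)) (μ (Sum.inl v)) = true ↔ G.Adj u v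
  identity : ∀ (K : CliqueOf Gp) (u v : V), u ∈ K.1 →
    (I (μ (Sum.inr K)) (κ K u) (μ (Sum.inl v)) = true ↔ u = v)
  length_vertex : ∀ v : V,
    ((μ (Sum.inl v)).length : ℝ) ≤ Real.logb 2 (∑ x, ω x) - Real.logb 2 (ω v) + b₁
  length_clique : ∀ K : CliqueOf Gp,
    ((μ (Sum.inr K)).length : ℝ) ≤
      Real.logb 2 (∑ x, ω x) - Real.logb 2 (K.1.inf' K.2.1 ω) + b₃
  length_local : ∀ (K : CliqueOf Gp) (u : V), u ∈ K.1 → ((κ K u).length : ℝ) ≤ b₂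

/-- `𝒢` admits a weighted `(g₁, g₂, g₃)` mixed labelling scheme: one pair of testers works for all
`n ≥ 1`, all `n`-vertex members `Gp` of `𝒢`, all spanning subgraphs `G` of `Gp` and all positive
real vertex weights. -/
def GraphClass.AdmitsMixedScheme (𝒢 : GraphClass) (g₁ g₂ g₃ : ℕ → ℝ) : Prop :=
  ∃ (A : List Bool → List Bool → Bool) (I : List Bool → List Bool → List Bool → Bool),
    ∀ (V : Type) [Fintype V] [Nonempty V] (Gp G : SimpleGraph V) (ω : V → ℝ),
      𝒢 V Gp → G ≤ Gp → (∀ v, 0 < ω v) →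
      ∃ (μ : V ⊕ CliqueOf Gp → List Bool) (κ : CliqueOf Gp → V → List Bool),
        IsWeightedMixedLabelling A I (g₁ (Fintype.card V)) (g₂ (Fintype.card V))
          (g₃ (Fintype.card V)) Gp G ω μ κ

/-- `𝒢` admits an efficient weighted mixed labelling scheme: each `gᵢ` is positive and `o(log n)`. -/
def GraphClass.AdmitsEfficientMixedScheme (𝒢 : GraphClass) : Prop :=
  ∃ g₁ g₂ g₃ : ℕ → ℝ,
    (∀ n, 0 < g₁ n) ∧ (∀ n, 0 < g₂ n) ∧ (∀ n, 0 < g₃ n) ∧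
    (g₁ =o[atTop] fun n : ℕ => Real.logb 2 n) ∧
    (g₂ =o[atTop] fun n : ℕ => Real.logb 2 n) ∧
    (g₃ =o[atTop] fun n : ℕ => Real.logb 2 n) ∧
    𝒢.AdmitsMixedScheme g₁ g₂ g₃

/-- A tree-decomposition of `G`, indexed by a finite tree. (`SimpleGraph.Connected` includes
non-emptiness.) -/
structure TreeDecomposition {V : Type} (G : SimpleGraph V) where
  Node : Type
  finite_node : Finite Node
  tree : SimpleGraph Node
  isTree : tree.IsTree
  bag : Node → Set V
  connected_bags : ∀ v : V, (tree.induce {x | v ∈ bag x}).Connected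
  edge_in_bag : ∀ u v : V, G.Adj u v → ∃ x, u ∈ bag x ∧ v ∈ bag x

/-- The adhesion-width, i.e. the maximum size of an adhesion, is at most `k`. -/
def TreeDecomposition.AdhesionWidthLE {V : Type} {G : SimpleGraph V}
    (D : TreeDecomposition G) (k : ℕ) : Prop :=
  ∀ x y : D.Node, x ≠ y → (D.bag x ∩ D.bag y).encard ≤ k

/-- The torso of the node `x`: the graph on the bag of `x` in which distinct `u`, `v` are adjacent
if they are adjacent in `G` or both lie in the bag of some neighbour `y` of `x`. -/
def TreeDecomposition.torso {V : Type} {G : SimpleGraph V} (D : TreeDecomposition G)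
    (x : D.Node) : SimpleGraph (D.bag x) where
  Adj u v := u ≠ v ∧ (G.Adj u v ∨ ∃ y, D.tree.Adj x y ∧ (u : V) ∈ D.bag y ∧ (v : V) ∈ D.bag y)
  symm := ⟨fun _ _ h => ⟨h.1.symm, h.2.imp (fun h => h.symm)
    (fun ⟨y, hy, hu, hv⟩ => ⟨y, hy, hv, hu⟩)⟩⟩
  loopless := ⟨fun _ h => h.1 rfl⟩

/-- The class of all graphs that have a tree-decomposition of adhesion-width at most `k` all of
whose torsos are in `𝒢`. -/
def GraphClass.treeClosure (𝒢 : GraphClass) (k : ℕ) : GraphClass :=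
  fun _ _ G => ∃ D : TreeDecomposition G,
    D.AdhesionWidthLE k ∧ ∀ x, 𝒢 (D.bag x) (D.torso x)

/-!
A tree-decomposition is rooted, and every vertex is stored at its *home*, the node closest to the
root whose bag contains it. Two adjacent vertices have the same home, or one of them lies in the
upward adhesion of the home of the other, a set of at most `k` vertices that is contained in a
clique of a torso (`TreeDecomposition.nonempty_adhesionForest`). So the label of a vertex `v`
consists of an address of its home, its label in the torso of its home, and pointers to its at most
`k` possible neighbours further up.

An address lists the steps from the root to the home. A step that leaves the torso of `y` towards a
child `w` can be described by the label of the clique `up w` in that torso, weighted so that the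
length of this label is the logarithm of the factor by which the weight of the subtree drops, plus
`g₃`. These lengths telescope to `log ω(G) - log ω(v)`, but each step costs an overhead of
`g₃ + O(log log n)`, so the number of steps has to be small. To this end the nodes are divided into
levels, according to the logarithm of the weight of their subtrees in units of
`σ = √(g₃ log n)` (`AdhesionForest.exists_levelling`). There are about
`log n / σ = √(log n / g₃)` levels, and only the steps between levels are recorded; this is
`AdhesionForest.Levelling.Code.tripleCost_chain_le`.

A component of nodes on one level is a tree with at most `2 ^ σ` leaves, because the weights on one
level differ by a factor of at most `2 ^ σ`. It is covered by at most `2 ^ σ` chains, and its nodes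
get positions from a weighted binary search tree in which every chain is an interval
(`exists_searchPath`). A vertex of an upward adhesion that is homed in the same component is
identified by a number of `σ + O(1)` bits if its bags in the component branch off a chain, and
otherwise by the node in which its interval of bags is centred, which is a prefix of the positions
of all these bags, together with one of `2 k` colours
(`AdhesionForest.Levelling.exists_identifiers`). Pointers across levels use the clique labels of the
recorded steps (`AdhesionForest.Levelling.Code.exists_pointer`). The pieces are assembled in
`AdhesionForest.exists_glued_labelling`, and the choice of `σ` balances the overheads
`g₃ log n / σ` and `σ`. Disjoint unions are never needed. The qualitative form follows from the
quantitative one applied to non-decreasing majorants.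
-/

/-! ### Self-delimiting codes -/

/-- A self-delimiting (prefix-free) form of a bit string: the size of its length in unary, its
length in binary, the string itself. -/
def delimit (x : List Bool) : List Bool :=
  List.replicate x.length.size true ++ false :: (x.length.bits ++ x)

theorem replicate_true_append_inj {a b : ℕ} {r s : List Bool}
    (h : List.replicate a true ++ false :: r = List.replicate b true ++ false :: s) :
    a = b ∧ r = s := by
  induction a generalizing b with
  | zero =>
    cases b with
    | zero => simpa using h
    | succ b => simp [List.replicate_succ] at h
  | succ a ih =>
    cases b with
    | zero => simp [List.replicate_succ] at h
    | succ b =>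
      simp only [List.replicate_succ, List.cons_append, List.cons.injEq, true_and] at h
      obtain ⟨h1, h2⟩ := ih h
      exact ⟨by omega, h2⟩

theorem bits_injective : Function.Injective Nat.bits := by
  have key : ∀ n : ℕ, n.bits.foldr Nat.bit 0 = n := by
    intro n
    induction n using Nat.binaryRec' with
    | zero => simp
    | bit b n h ih => rw [Nat.bits_append_bit n b h, List.foldr_cons, ih]
  intro a b h
  rw [← key a, ← key b, h]

theorem delimit_append_inj {x y r s : List Bool} (h : delimit x ++ r = delimit y ++ s) :
    x = y ∧ r = s := by
  simp only [delimit, List.append_assoc, List.cons_append] at h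
  obtain ⟨h1, h2⟩ := replicate_true_append_inj h
  obtain ⟨h3, h4⟩ := List.append_inj h2 (by rw [Nat.size_eq_bits_len, Nat.size_eq_bits_len, h1])
  exact List.append_inj h4 (bits_injective h3)

theorem length_delimit (x : List Bool) :
    (delimit x).length = x.length + 2 * x.length.size + 1 := by
  simp only [delimit, List.length_append, List.length_replicate, List.length_cons,
    Nat.size_eq_bits_len]
  omega

/-- A prefix-free code for lists of triples of bit strings. -/
def encodeTriples : List (List Bool × List Bool × List Bool) → List Bool
  | [] => [false]
  | e :: l => true :: (delimit e.1 ++ (delimit e.2.1 ++ (delimit e.2.2 ++ encodeTriples l)))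

theorem encodeTriples_append_inj {l m : List (List Bool × List Bool × List Bool)}
    {r s : List Bool} (h : encodeTriples l ++ r = encodeTriples m ++ s) : l = m ∧ r = s := by
  induction l generalizing m with
  | nil =>
    cases m with
    | nil => simpa [encodeTriples] using h
    | cons e m => simp [encodeTriples] at h
  | cons e l ih =>
    cases m with
    | nil => simp [encodeTriples] at h
    | cons e' m =>
      simp only [encodeTriples, List.cons_append, List.append_assoc, List.cons.injEq,
        true_and] at h
      obtain ⟨h1, h⟩ := delimit_append_inj h
      obtain ⟨h2, h⟩ := delimit_append_inj h
      obtain ⟨h3, h⟩ := delimit_append_inj h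
      obtain ⟨h4, h⟩ := ih h
      exact ⟨by rw [h4, Prod.ext h1 (Prod.ext h2 h3)], h⟩

/-- The total length of the strings in a list of triples, each triple being charged an extra
`c`. -/
noncomputable def tripleCost (c : ℝ) (l : List (List Bool × List Bool × List Bool)) : ℝ :=
  (l.map fun e => ((e.1.length : ℝ) + e.2.1.length + e.2.2.length + c)).sum

theorem length_encodeTriples_le {N : ℕ} (l : List (List Bool × List Bool × List Bool))
    (h : ∀ e ∈ l, e.1.length ≤ N ∧ e.2.1.length ≤ N ∧ e.2.2.length ≤ N) :
    ((encodeTriples l).length : ℝ) ≤ tripleCost (6 * N.size + 4) l + 1 := by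
  induction l with
  | nil => simp [encodeTriples, tripleCost]
  | cons e l ih =>
    obtain ⟨h1, h2, h3⟩ := h e (by simp)
    have ih := ih fun e he => h e (by simp [he])
    have h1' : (e.1.length.size : ℝ) ≤ N.size := by exact_mod_cast Nat.size_le_size h1
    have h2' : (e.2.1.length.size : ℝ) ≤ N.size := by exact_mod_cast Nat.size_le_size h2
    have h3' : (e.2.2.length.size : ℝ) ≤ N.size := by exact_mod_cast Nat.size_le_size h3
    simp only [encodeTriples, List.length_cons, List.length_append, length_delimit, tripleCost,
      List.map_cons, List.sum_cons] at ih ⊢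
    push_cast
    linarith

/-! ### Weighted binary search trees -/

/-- A weighted median splits a finite linear order into halves. -/
theorem exists_weighted_median {α β : Type*} [LinearOrder β] (key : α → β) (S : Finset α)
    (hS : S.Nonempty) (w : α → ℝ) (hw : ∀ x ∈ S, 0 < w x) :
    ∃ r ∈ S, ∑ x ∈ S with key x < key r, w x ≤ (∑ x ∈ S, w x) / 2 ∧
      ∑ x ∈ S with key r < key x, w x ≤ (∑ x ∈ S, w x) / 2 := by
  classical
  set Ω := ∑ x ∈ S, w x with hΩ
  have hΩ0 : 0 < Ω := Finset.sum_pos hw hS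
  set T := S.filter fun r => Ω / 2 ≤ ∑ x ∈ S with key x ≤ key r, w x with hT
  have hTne : T.Nonempty := by
    obtain ⟨m, hm, hmax⟩ := S.exists_max_image key hS
    refine ⟨m, Finset.mem_filter.2 ⟨hm, ?_⟩⟩
    rw [Finset.filter_true_of_mem hmax]
    linarith
  obtain ⟨r, hr, hmin⟩ := T.exists_min_image key hTne
  obtain ⟨hrS, hr2⟩ := Finset.mem_filter.1 hr
  refine ⟨r, hrS, ?_, ?_⟩
  · by_cases he : (S.filter fun x => key x < key r).Nonempty
    · obtain ⟨m, hm, hmax⟩ := Finset.exists_max_image _ key he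
      obtain ⟨hmS, hmr⟩ := Finset.mem_filter.1 hm
      have hmT : m ∉ T := fun h => absurd (hmin m h) (not_le.2 hmr)
      have hlt : ∑ x ∈ S with key x ≤ key m, w x < Ω / 2 := by
        by_contra hc
        exact hmT (Finset.mem_filter.2 ⟨hmS, not_lt.1 hc⟩)
      refine le_trans (le_of_eq (Finset.sum_congr ?_ fun _ _ => rfl)) hlt.le
      ext x
      simp only [Finset.mem_filter]
      exact ⟨fun h => ⟨h.1, hmax x (Finset.mem_filter.2 h)⟩, fun h => ⟨h.1, h.2.trans_lt hmr⟩⟩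
    · rw [Finset.not_nonempty_iff_eq_empty.1 he]
      simp only [Finset.sum_empty]
      linarith
  · have := Finset.sum_filter_add_sum_filter_not S (fun x => key x ≤ key r) w
    simp only [not_le] at this
    linarith

/-- Weighted binary search tree: the elements of a finite linearly ordered set get distinct bit
strings (their search paths) of length at most `log (W / w x)`, and every convex set contains an
element whose search path is a prefix of the search paths of the whole set. -/
theorem exists_searchPath {α β : Type*} [LinearOrder β] (key : α → β) (S : Finset α)
    (hkey : Set.InjOn key S) (w : α → ℝ) (hw : ∀ x ∈ S, 0 < w x) :
    ∃ pos : α → List Bool, Set.InjOn pos S ∧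
      (∀ x ∈ S, ((pos x).length : ℝ) ≤ Real.logb 2 (∑ x ∈ S, w x) - Real.logb 2 (w x)) ∧
      ∀ J : Set α, J ⊆ S → J.Nonempty →
        (∀ a ∈ J, ∀ b ∈ J, ∀ c ∈ S, key a ≤ key c → key c ≤ key b → c ∈ J) →
        ∃ b ∈ J, ∀ y ∈ J, pos b <+: pos y := by
  classical
  induction S using Finset.strongInduction with
  | H S ih =>
  rcases S.eq_empty_or_nonempty with rfl | hS
  · refine ⟨fun _ => [], by simp, by simp, ?_⟩
    intro J hJ hne
    obtain ⟨x, hx⟩ := hne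
    exact absurd (hJ hx) (by simp)
  obtain ⟨r, hr, hlo, hhi⟩ := exists_weighted_median key S hS w hw
  set Ω := ∑ x ∈ S, w x with hΩ
  have hΩ0 : 0 < Ω := Finset.sum_pos hw hS
  set L := S.filter fun x => key x < key r with hL
  set R := S.filter fun x => key r < key x with hR
  have hLS : L ⊂ S := Finset.filter_ssubset.2 ⟨r, hr, lt_irrefl _⟩
  have hRS : R ⊂ S := Finset.filter_ssubset.2 ⟨r, hr, lt_irrefl _⟩
  obtain ⟨p, hp1, hp2, hp3⟩ := ih L hLS (hkey.mono hLS.1) fun x hx => hw x (hLS.1 hx)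
  obtain ⟨q, hq1, hq2, hq3⟩ := ih R hRS (hkey.mono hRS.1) fun x hx => hw x (hRS.1 hx)
  have half : ∀ (X : Finset α) (x : α), x ∈ X → X ⊆ S → ∑ x ∈ X, w x ≤ Ω / 2 →
      Real.logb 2 (∑ x ∈ X, w x) + 1 ≤ Real.logb 2 Ω := by
    intro X x hx hXS hX
    have h0 : 0 < ∑ x ∈ X, w x := Finset.sum_pos (fun y hy => hw y (hXS hy)) ⟨x, hx⟩
    have : Real.logb 2 (∑ x ∈ X, w x) ≤ Real.logb 2 (Ω / 2) :=
      Real.logb_le_logb_of_le (by norm_num) h0 hX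
    rw [Real.logb_div hΩ0.ne' (by norm_num), Real.logb_self_eq_one (by norm_num)] at this
    linarith
  refine ⟨fun x => if key x < key r then false :: p x else
    if key r < key x then true :: q x else [], ?_, ?_, ?_⟩
  · intro x hx y hy hxy
    have inL : ∀ z ∈ S, key z < key r → z ∈ L := fun z hz h => Finset.mem_filter.2 ⟨hz, h⟩
    have inR : ∀ z ∈ S, key r < key z → z ∈ R := fun z hz h => Finset.mem_filter.2 ⟨hz, h⟩
    rcases lt_trichotomy (key x) (key r) with h1 | h1 | h1 <;>
      rcases lt_trichotomy (key y) (key r) with h2 | h2 | h2 <;>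
      simp only [h1, h2, h1.not_gt, h2.not_gt, if_true, if_false, lt_irrefl, List.cons.injEq,
        true_and, reduceCtorEq, false_and, Bool.false_eq_true] at hxy
    · exact hp1 (inL x hx h1) (inL y hy h2) hxy
    · exact hkey hx hy (h1.trans h2.symm)
    · exact hq1 (inR x hx h1) (inR y hy h2) hxy
  · intro x hx
    dsimp only
    split_ifs with h1 h2
    · have hxL : x ∈ L := Finset.mem_filter.2 ⟨hx, h1⟩
      have := half L x hxL hLS.1 hlo
      have := hp2 x hxL
      push_cast [List.length_cons]
      linarith
    · have hxR : x ∈ R := Finset.mem_filter.2 ⟨hx, h2⟩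
      have := half R x hxR hRS.1 hhi
      have := hq2 x hxR
      push_cast [List.length_cons]
      linarith
    · have : Real.logb 2 (w x) ≤ Real.logb 2 Ω :=
        Real.logb_le_logb_of_le (by norm_num) (hw x hx)
          (Finset.single_le_sum (fun y hy => (hw y hy).le) hx)
      simp only [List.length_nil, Nat.cast_zero]
      linarith
  · intro J hJS hJ hconv
    by_cases hrJ : r ∈ J
    · refine ⟨r, hrJ, fun y _ => ?_⟩
      simp
    -- a convex set that misses the root lies on one side of it
    have side : (∀ x ∈ J, key x < key r) ∨ (∀ x ∈ J, key r < key x) := by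
      by_contra hc
      push Not at hc
      obtain ⟨⟨a, ha, har⟩, ⟨b, hb, hbr⟩⟩ := hc
      exact hrJ (hconv b hb a ha r hr hbr har)
    rcases side with h | h
    · obtain ⟨b, hb, hpre⟩ := hp3 J (fun x hx => Finset.mem_filter.2 ⟨hJS hx, h x hx⟩) hJ
        fun a ha b hb c hc => hconv a ha b hb c (hLS.1 hc)
      refine ⟨b, hb, fun y hy => ?_⟩
      simp only [h b hb, h y hy, if_true]
      simpa using hpre y hy
    · obtain ⟨b, hb, hpre⟩ := hq3 J (fun x hx => Finset.mem_filter.2 ⟨hJS hx, h x hx⟩) hJ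
        fun a ha b hb c hc => hconv a ha b hb c (hRS.1 hc)
      refine ⟨b, hb, fun y hy => ?_⟩
      simp only [h b hb, h y hy, (h b hb).not_gt, (h y hy).not_gt, if_true, if_false]
      simpa using hpre y hy

/-- Distinct code words of length at most `log (W / w x)` for the elements of a finite set. -/
theorem exists_weightedCode {α : Type*} (S : Finset α) (w : α → ℝ) (hw : ∀ x ∈ S, 0 < w x) :
    ∃ f : α → List Bool, Set.InjOn f S ∧
      ∀ x ∈ S, ((f x).length : ℝ) ≤ Real.logb 2 (∑ x ∈ S, w x) - Real.logb 2 (w x) := by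
  classical
  let _ : LinearOrder α := linearOrderOfSTO (WellOrderingRel (α := α))
  obtain ⟨f, h1, h2, -⟩ := exists_searchPath (id : α → α) S Function.injective_id.injOn w hw
  exact ⟨f, h1, h2⟩

/-- Distinct code words of length at most `log |S|` for the elements of a finite set `S`. -/
theorem exists_code {α : Type*} (S : Finset α) :
    ∃ f : α → List Bool, Set.InjOn f S ∧
      ∀ x ∈ S, ((f x).length : ℝ) ≤ Real.logb 2 S.card := by
  simpa using exists_weightedCode S (fun _ => (1 : ℝ)) (by simp)

/-! ### Rooted forests of small adhesions -/

/-- What remains of a tree-decomposition once its tree is rooted and every vertex is stored only at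
its *home*, the node closest to the root whose bag contains it. Nodes that are nobody's home are
dropped, so `parent w` is the home of the deepest vertex in the upward adhesion `up w`, and a node
with empty upward adhesion is a root. The torso of a node is restricted to the vertices whose home
it is. -/
structure AdhesionForest {V : Type} [Finite V] (Gp : SimpleGraph V) (𝒢 : GraphClass) (k : ℕ) where
  Node : Type
  finite_node : Finite Node
  home : V → Node
  home_surjective : Function.Surjective home
  parent : Node → Option Node
  depth : Node → ℕ
  depth_parent : ∀ w y, parent w = some y → depth w = depth y + 1
  up : Node → Finset V
  card_up : ∀ w, (up w).card ≤ k
  up_step : ∀ w, ∀ u ∈ up w, ∃ y, parent w = some y ∧ (home u = y ∨ u ∈ up y)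
  up_home : ∀ w y, parent w = some y → ∃ u ∈ up w, home u = y
  torso : ∀ y : Node, SimpleGraph {v // home v = y}
  torso_mem : ∀ y, 𝒢 {v // home v = y} (torso y)
  torso_of_adj : ∀ y (u v : {v // home v = y}), Gp.Adj u v → (torso y).Adj u v
  torso_of_up : ∀ w y, parent w = some y → ∀ u v : {v // home v = y}, u.1 ∈ up w → v.1 ∈ up w →
    u ≠ v → (torso y).Adj u v
  adj_home : ∀ u v, Gp.Adj u v → home u = home v ∨ u ∈ up (home v) ∨ v ∈ up (home u)

/-- In a rooted tree every edge joins a node to its parent. -/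
theorem SimpleGraph.IsTree.exists_parent {N : Type*} {T : SimpleGraph N} (hT : T.IsTree) (r : N) :
    ∃ par : N → N, ∀ a b, T.Adj a b → (par b = a ∧ T.dist r b = T.dist r a + 1) ∨
      (par a = b ∧ T.dist r a = T.dist r b + 1) := by
  classical
  have uniq : ∀ a a' b, T.Adj a b → T.Adj a' b → T.dist r b = T.dist r a + 1 →
      T.dist r b = T.dist r a' + 1 → a = a' := by
    intro a a' b ha ha' hd hd'
    obtain ⟨p, hp, hpd⟩ := hT.connected.exists_path_of_dist r b
    have key : ∀ a, T.Adj a b → T.dist r b = T.dist r a + 1 → a = p.penultimate := by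
      intro a ha hd
      obtain ⟨q, hq, hqd⟩ := hT.connected.exists_path_of_dist r a
      have hb : b ∉ q.support := by
        intro hb
        have h1 := SimpleGraph.dist_le (q.takeUntil b hb)
        have h2 := q.length_takeUntil_le_length hb
        omega
      exact hT.isAcyclic.eq_penultimate_of_adj_end hp ha.symm
        (hT.isAcyclic.mem_support_of_ne_mem_support_of_adj_of_isPath hp hq ha.symm hb)
    rw [key a ha hd, key a' ha' hd']
  refine ⟨fun b => if h : ∃ a, T.Adj a b ∧ T.dist r b = T.dist r a + 1 then h.choose else b, ?_⟩
  have hpar : ∀ a b, T.Adj a b → T.dist r b = T.dist r a + 1 →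
      (if h : ∃ a, T.Adj a b ∧ T.dist r b = T.dist r a + 1 then h.choose else b) = a := by
    intro a b hab hd
    have h : ∃ a, T.Adj a b ∧ T.dist r b = T.dist r a + 1 := ⟨a, hab, hd⟩
    rw [dif_pos h]
    exact uniq _ _ b h.choose_spec.1 hab h.choose_spec.2 hd
  intro a b hab
  rcases hT.dist_eq_dist_add_one_of_adj r hab with h | h
  · exact Or.inr ⟨hpar b a hab.symm h, h⟩
  · exact Or.inl ⟨hpar a b hab h, h⟩

/-- A connected set of nodes of a rooted tree is closed under parents, up to its top node. -/
theorem parent_mem_of_connected {N : Type*} {T : SimpleGraph N} {par : N → N} {d : N → ℕ}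
    (hpar : ∀ a b, T.Adj a b → (par b = a ∧ d b = d a + 1) ∨ (par a = b ∧ d a = d b + 1))
    {S : Set N} (hS : (T.induce S).Connected) {h x : N} (hh : h ∈ S) (hmin : ∀ y ∈ S, d h ≤ d y)
    (hx : x ∈ S) (hxh : x ≠ h) : par x ∈ S ∧ T.Adj x (par x) ∧ d x = d (par x) + 1 := by
  by_contra hc
  -- a walk in `S` that starts at `x` and avoids the parent of `x` stays below `x`
  have walk : ∀ (a b : S) (_ : (T.induce S).Walk a b),
      (∃ i, par^[i] a = x ∧ d a = d x + i) → ∃ i, par^[i] b = x ∧ d b = d x + i := by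
    intro a b p
    induction p with
    | nil => exact id
    | @cons a b c hab p ih =>
      rintro ⟨i, hi, hd⟩
      apply ih
      have hab : T.Adj a b := hab
      rcases hpar a b hab with ⟨h1, h2⟩ | ⟨h1, h2⟩
      · exact ⟨i + 1, by rw [Function.iterate_succ_apply, h1, hi], by omega⟩
      · cases i with
        | zero =>
          simp only [Function.iterate_zero, id] at hi
          rw [hi] at h1 h2 hab
          exact absurd ⟨h1 ▸ b.2, h1 ▸ hab, by rw [h1, h2]⟩ hc
        | succ j =>
          rw [Function.iterate_succ_apply, h1] at hi
          exact ⟨j, hi, by omega⟩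
  obtain ⟨p⟩ := hS.preconnected ⟨x, hx⟩ ⟨h, hh⟩
  obtain ⟨i, hi, hd⟩ := walk _ _ p ⟨0, rfl, by simp⟩
  have := hmin x hx
  have : i = 0 := by simp only at hd; omega
  subst this
  exact hxh (by simpa using hi.symm)

/-- A rank function that increases along parents can be replaced by one that increases by one. -/
theorem exists_depth {N : Type*} [Finite N] (parent : N → Option N) (rk : N → ℕ)
    (h : ∀ w y, parent w = some y → rk y < rk w) :
    ∃ depth : N → ℕ, ∀ w y, parent w = some y → depth w = depth y + 1 := by
  have key : ∀ n, ∃ depth : N → ℕ, ∀ w y, rk w ≤ n → parent w = some y →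
      depth w = depth y + 1 := by
    intro n
    induction n with
    | zero => exact ⟨fun _ => 0, fun w y hw hp => by have := h w y hp; omega⟩
    | succ n ih =>
      obtain ⟨f, hf⟩ := ih
      refine ⟨fun w => if rk w ≤ n then f w else (parent w).elim 0 fun y => f y + 1, ?_⟩
      intro w y hw hp
      have hy := h w y hp
      have hy' : rk y ≤ n := by omega
      by_cases hwn : rk w ≤ n
      · simp only [hwn, hy', if_true]
        exact hf w y hwn hp
      · simp [hwn, hy', hp]
  obtain ⟨n, hn⟩ := (Set.finite_range rk).bddAbove
  obtain ⟨f, hf⟩ := key n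
  exact ⟨f, fun w y hp => hf w y (hn ⟨w, rfl⟩) hp⟩

/-- Rooting a tree-decomposition of adhesion-width at most `k` gives an adhesion forest. The parent
of a node `w` in the forest need not be its parent in the tree, but it lies on the way to the root,
and the child of the former towards `w` shows that the part of the upward adhesion of `w` that lives
there is a clique of the torso. -/
theorem TreeDecomposition.nonempty_adhesionForest {V : Type} [Finite V] {Gp : SimpleGraph V}
    {𝒢 : GraphClass} (h𝒢 : 𝒢.Hereditary) {k : ℕ} (D : TreeDecomposition Gp)
    (hk : D.AdhesionWidthLE k) (hD : ∀ x, 𝒢 (D.bag x) (D.torso x)) :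
    Nonempty (AdhesionForest Gp 𝒢 k) := by
  classical
  obtain ⟨r⟩ := D.isTree.connected.nonempty
  obtain ⟨par, hpar⟩ := D.isTree.exists_parent r
  set d : D.Node → ℕ := D.tree.dist r with hd
  have hhome : ∀ v, ∃ h, v ∈ D.bag h ∧ ∀ y, v ∈ D.bag y → d h ≤ d y := by
    intro v
    obtain ⟨⟨x, hx⟩⟩ := (D.connected_bags v).nonempty
    obtain ⟨h, h1, h2⟩ := WellFounded.has_min (measure d).wf {x | v ∈ D.bag x} ⟨x, hx⟩
    exact ⟨h, h1, fun y hy => not_lt.1 (h2 y hy)⟩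
  choose home hhome hmin using hhome
  have step : ∀ v x, v ∈ D.bag x → x ≠ home v →
      v ∈ D.bag (par x) ∧ D.tree.Adj x (par x) ∧ d x = d (par x) + 1 := fun v x hx hne =>
    parent_mem_of_connected hpar (D.connected_bags v) (hhome v) (hmin v) hx hne
  have top : ∀ v x, v ∈ D.bag x → d x ≤ d (home v) → x = home v := by
    intro v x hx hle
    by_contra hne
    obtain ⟨h1, -, h2⟩ := step v x hx hne
    have := hmin v _ h1
    omega
  have climb : ∀ v x i, v ∈ D.bag x → d (home v) + i ≤ d x →
      v ∈ D.bag (par^[i] x) ∧ d (par^[i] x) + i = d x := by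
    intro v x i hx
    induction i with
    | zero => intro _; exact ⟨hx, rfl⟩
    | succ i ih =>
      intro hi
      obtain ⟨h1, h2⟩ := ih (by omega)
      obtain ⟨h3, -, h4⟩ := step v _ h1 (by intro h; rw [h] at h2; omega)
      rw [Function.iterate_succ_apply']
      exact ⟨h3, by omega⟩
  have reach : ∀ v x, v ∈ D.bag x → par^[d x - d (home v)] x = home v := by
    intro v x hx
    have := hmin v x hx
    obtain ⟨h1, h2⟩ := climb v x (d x - d (home v)) hx (by omega)
    exact top v _ h1 (by omega)
  have meet : ∀ u v x, u ∈ D.bag x → v ∈ D.bag x → d (home u) ≤ d (home v) →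
      u ∈ D.bag (home v) := by
    intro u v x hu hv hle
    have := hmin v x hv
    rw [← reach v x hv]
    exact (climb u x _ hu (by omega)).1
  -- the upward adhesion of a node
  let K : D.Node → Set V := fun x => {v | v ∈ D.bag x ∧ home v ≠ x}
  have hKd : ∀ x u, u ∈ K x → d (home u) < d x := by
    intro x u hu
    by_contra hc
    exact hu.2 (top u x hu.1 (not_lt.1 hc)).symm
  have hKcard : ∀ x, (K x).toFinite.toFinset.card ≤ k := by
    intro x
    rcases (K x).eq_empty_or_nonempty with h | ⟨u, hu⟩
    · simp [h]
    · have h1 : K x ⊆ D.bag x ∩ D.bag (par x) := fun v hv =>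
        ⟨hv.1, (step v x hv.1 (Ne.symm hv.2)).1⟩
      have h2 := hk x (par x) (step u x hu.1 (Ne.symm hu.2)).2.1.ne
      have h3 := (Set.encard_le_encard h1).trans h2
      rw [(K x).toFinite.encard_eq_coe_toFinset_card] at h3
      exact_mod_cast h3
  have hpick : ∀ x, (K x).Nonempty → ∃ u ∈ K x, ∀ v ∈ K x, d (home v) ≤ d (home u) := fun x hx =>
    Set.exists_max_image (K x) (fun u => d (home u)) (K x).toFinite hx
  let N := {x // ∃ v, home v = x}
  let parent : N → Option N := fun w =>
    if h : (K w.1).Nonempty then some ⟨home (hpick w.1 h).choose, _, rfl⟩ else none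
  have hparent : ∀ w y, parent w = some y → ∃ u ∈ K w.1, home u = y.1 ∧
      ∀ v ∈ K w.1, d (home v) ≤ d y.1 := by
    intro w y h
    simp only [parent] at h
    split_ifs at h with hK
    · obtain ⟨h1, h2⟩ := (hpick w.1 hK).choose_spec
      have := Option.some.inj h
      rw [← this]
      exact ⟨_, h1, rfl, h2⟩
  have hrk : ∀ w y, parent w = some y → d y.1 < d w.1 := by
    intro w y h
    obtain ⟨u, hu, hy, -⟩ := hparent w y h
    rw [← hy]
    exact hKd _ _ hu
  have hfin : Finite N := Finite.of_surjective (fun v : V => (⟨home v, v, rfl⟩ : N))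
    (by rintro ⟨x, v, rfl⟩; exact ⟨v, rfl⟩)
  obtain ⟨depth, hdepth⟩ := exists_depth parent (fun w => d w.1) hrk
  have hbag : ∀ (y : N) (v : {v // (⟨home v, v, rfl⟩ : N) = y}), v.1 ∈ D.bag y.1 := by
    rintro y ⟨v, rfl⟩
    exact hhome v
  refine ⟨{
    Node := N
    finite_node := hfin
    home := fun v => ⟨home v, v, rfl⟩
    home_surjective := by rintro ⟨x, v, rfl⟩; exact ⟨v, rfl⟩
    parent := parent
    depth := depth
    depth_parent := hdepth
    up := fun w => (K w.1).toFinite.toFinset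
    card_up := fun w => hKcard w.1
    up_step := ?_
    up_home := ?_
    torso := fun y => (D.torso y.1).comap fun v => ⟨v.1, hbag y v⟩
    torso_mem := ?_
    torso_of_adj := ?_
    torso_of_up := ?_
    adj_home := ?_ }⟩
  · intro w u hu
    rw [Set.Finite.mem_toFinset] at hu
    have hne : (K w.1).Nonempty := ⟨u, hu⟩
    obtain ⟨y, hy⟩ : ∃ y, parent w = some y := by simp [parent, hne]
    refine ⟨y, hy, ?_⟩
    obtain ⟨u', hu', hy', hmax⟩ := hparent w y hy
    rw [Set.Finite.mem_toFinset]
    by_cases hh : home u = y.1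
    · exact Or.inl (Subtype.ext hh)
    · refine Or.inr ⟨?_, hh⟩
      rw [← hy']
      exact meet u u' w.1 hu.1 hu'.1 (hy' ▸ hmax u hu)
  · intro w y h
    obtain ⟨u, hu, hy, -⟩ := hparent w y h
    exact ⟨u, by rwa [Set.Finite.mem_toFinset], Subtype.ext hy⟩
  · intro y
    refine h𝒢 _ _ _ _ (hD y.1) ⟨⟨⟨fun v => ⟨v.1, hbag y v⟩, ?_⟩, Iff.rfl⟩⟩
    intro a b hab
    exact Subtype.ext (congrArg (fun z : D.bag y.1 => z.1) hab)
  · intro y u v h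
    exact ⟨fun he => h.ne (congrArg (fun z : D.bag y.1 => z.1) he), Or.inl h⟩
  · rintro w y h ⟨u, hu⟩ ⟨v, hv⟩ huK hvK hne
    rw [Set.Finite.mem_toFinset] at huK hvK
    have hu' : home u = y.1 := congrArg Subtype.val hu
    have hv' : home v = y.1 := congrArg Subtype.val hv
    have hlt := hrk w y h
    obtain ⟨h1, h2⟩ := climb u w.1 (d w.1 - d y.1 - 1) huK.1 (by rw [hu']; omega)
    obtain ⟨h3, -⟩ := climb v w.1 (d w.1 - d y.1 - 1) hvK.1 (by rw [hv']; omega)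
    -- the neighbour of `y` on the way down to `w`
    set c := par^[d w.1 - d y.1 - 1] w.1 with hc
    have hcy : c ≠ home u := by intro h; rw [h, hu'] at h2; omega
    obtain ⟨h4, h5, h6⟩ := step u c h1 hcy
    have hpc : par c = home u := top u _ h4 (by rw [hu']; omega)
    refine ⟨fun he => hne (Subtype.ext (congrArg (fun z : D.bag y.1 => z.1) he)),
      Or.inr ⟨c, ?_, h1, h3⟩⟩
    rw [← hu', ← hpc]
    exact h5.symm
  · intro u v h
    obtain ⟨x, hu, hv⟩ := D.edge_in_bag u v h
    simp only [Set.Finite.mem_toFinset]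
    by_cases he : home u = home v
    · exact Or.inl (Subtype.ext he)
    · rcases le_total (d (home u)) (d (home v)) with hle | hle
      · exact Or.inr (Or.inl ⟨meet u v x hu hv hle, he⟩)
      · exact Or.inr (Or.inr ⟨meet v u x hv hu hle, Ne.symm he⟩)

/-! ### Ancestors and weights in an adhesion forest -/

namespace AdhesionForest

noncomputable instance {V : Type} [Finite V] {Gp : SimpleGraph V} {𝒢 : GraphClass} {k : ℕ}
    (F : AdhesionForest Gp 𝒢 k) : Fintype F.Node :=
  have := F.finite_node
  Fintype.ofFinite _

section Ancestors

variable {V : Type} [Finite V] {Gp : SimpleGraph V} {𝒢 : GraphClass} {k : ℕ}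
  (F : AdhesionForest Gp 𝒢 k)

/-- `F.Below x y`: the node `y` is `x` or an ancestor of `x`. -/
def Below (x y : F.Node) : Prop := Relation.ReflTransGen (fun a b => F.parent a = some b) x y

/-- Recursion along the forest, from the roots downwards. -/
noncomputable def fold {α : Type*} (f : F.Node → Option α → α) (w : F.Node) : α :=
  match _h : F.parent w with
  | none => f w none
  | some y => f w (some (fold f y))
termination_by F.depth w
decreasing_by
  have := F.depth_parent w y _h
  omega

variable {F}

theorem fold_none {α : Type*} (f : F.Node → Option α → α) {w : F.Node} (h : F.parent w = none) :
    F.fold f w = f w none := by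
  rw [fold]
  split
  · rfl
  · next h' => rw [h] at h'; cases h'

theorem fold_some {α : Type*} (f : F.Node → Option α → α) {w y : F.Node}
    (h : F.parent w = some y) : F.fold f w = f w (some (F.fold f y)) := by
  rw [fold]
  split
  · next h' => rw [h] at h'; cases h'
  · next h' => rw [h] at h'; cases h'; rfl

theorem Below.refl (x : F.Node) : F.Below x x := Relation.ReflTransGen.refl

theorem Below.trans {x y z : F.Node} (h : F.Below x y) (h' : F.Below y z) : F.Below x z :=
  Relation.ReflTransGen.trans h h'

theorem Below.parent {x y : F.Node} (h : F.parent x = some y) : F.Below x y :=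
  Relation.ReflTransGen.single h

theorem Below.total {x y z : F.Node} (h : F.Below x y) (h' : F.Below x z) :
    F.Below y z ∨ F.Below z y := by
  refine Relation.ReflTransGen.total_of_right_unique ?_ h h'
  intro a b c hb hc
  exact Option.some.inj (hb.symm.trans hc)

theorem Below.depth_le {x y : F.Node} (h : F.Below x y) : F.depth y ≤ F.depth x := by
  induction h with
  | refl => exact le_rfl
  | tail _ h ih => have := F.depth_parent _ _ h; omega

theorem Below.eq_of_depth {x y : F.Node} (h : F.Below x y) (hd : F.depth x ≤ F.depth y) :
    x = y := by
  rcases Relation.ReflTransGen.cases_head h with h | ⟨z, hz, h⟩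
  · exact h
  · have := F.depth_parent _ _ hz
    have := Below.depth_le h
    omega

theorem Below.eq_of_depth_eq {x y z : F.Node} (h : F.Below x y) (h' : F.Below x z)
    (hd : F.depth y = F.depth z) : y = z := by
  rcases h.total h' with h | h
  · exact h.eq_of_depth hd.le
  · exact (h.eq_of_depth hd.ge).symm

/-- A vertex of an upward adhesion lives at a proper ancestor. -/
theorem below_home_of_mem_up {w : F.Node} {u : V} (hu : u ∈ F.up w) :
    F.Below w (F.home u) ∧ F.depth (F.home u) < F.depth w := by
  induction hd : F.depth w using Nat.strong_induction_on generalizing w with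
  | _ n ih =>
    obtain ⟨y, hy, h⟩ := F.up_step w u hu
    have h1 := F.depth_parent w y hy
    rcases h with h | h
    · rw [h]
      exact ⟨Below.parent hy, by omega⟩
    · obtain ⟨h2, h3⟩ := ih (F.depth y) (by omega) h rfl
      exact ⟨(Below.parent hy).trans h2, by omega⟩

end Ancestors

section Weight

variable {V : Type} [Fintype V] {Gp : SimpleGraph V} {𝒢 : GraphClass} {k : ℕ}
  (F : AdhesionForest Gp 𝒢 k)

open Classical in
/-- The vertices whose home is `y` or a descendant of `y`. -/
noncomputable def desc (y : F.Node) : Finset V := {v | F.Below (F.home v) y}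

/-- The total weight of the vertices whose home is `y` or a descendant of `y`. -/
noncomputable def weight (ω : V → ℝ) (y : F.Node) : ℝ := ∑ v ∈ F.desc y, ω v

variable {F}

theorem mem_desc {y : F.Node} {v : V} : v ∈ F.desc y ↔ F.Below (F.home v) y := by
  simp [desc]

theorem desc_subset {x y : F.Node} (h : F.Below x y) : F.desc x ⊆ F.desc y := by
  intro v hv
  rw [mem_desc] at hv ⊢
  exact hv.trans h

theorem disjoint_desc {x y : F.Node} (hd : F.depth x = F.depth y) (h : x ≠ y) :
    Disjoint (F.desc x) (F.desc y) := by
  rw [Finset.disjoint_left]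
  intro v hx hy
  rw [mem_desc] at hx hy
  exact h (hx.eq_of_depth_eq hy hd)

theorem disjoint_desc_of_root {x y : F.Node} (hx : F.parent x = none) (hy : F.parent y = none)
    (h : x ≠ y) : Disjoint (F.desc x) (F.desc y) := by
  have key : ∀ {x y : F.Node}, F.parent x = none → F.Below x y → x = y := by
    intro x y hx hb
    rcases Relation.ReflTransGen.cases_head hb with h | ⟨z, hz, -⟩
    · exact h
    · rw [hx] at hz; cases hz
  rw [Finset.disjoint_left]
  intro v h1 h2
  rw [mem_desc] at h1 h2
  rcases h1.total h2 with h3 | h3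
  · exact h (key hx h3)
  · exact h (key hy h3).symm

theorem weight_pos {ω : V → ℝ} (hω : ∀ v, 0 < ω v) (y : F.Node) : 0 < F.weight ω y := by
  obtain ⟨v, hv⟩ := F.home_surjective y
  exact Finset.sum_pos (fun v _ => hω v) ⟨v, mem_desc.2 (hv ▸ Below.refl _)⟩

theorem weight_mono {ω : V → ℝ} (hω : ∀ v, 0 < ω v) {x y : F.Node} (h : F.Below x y) :
    F.weight ω x ≤ F.weight ω y :=
  Finset.sum_le_sum_of_subset_of_nonneg (desc_subset h) fun v _ _ => (hω v).le

end Weight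

/-! ### Levels and their components -/

section Levelling

variable {V : Type} [Fintype V] {Gp : SimpleGraph V} {𝒢 : GraphClass} {k : ℕ}

/-- A level for every node that does not decrease along descents. -/
structure Levelling (F : AdhesionForest Gp 𝒢 k) where
  lev : F.Node → ℕ
  mono : ∀ w y, F.parent w = some y → lev y ≤ lev w

namespace Levelling

variable {F : AdhesionForest Gp 𝒢 k} (Λ : F.Levelling)

/-- `w` is a child of `y` on the same level. -/
def Same (w y : F.Node) : Prop := F.parent w = some y ∧ Λ.lev w = Λ.lev y

/-- `w` is a child of `y` on a larger level. -/
def Light (w y : F.Node) : Prop := F.parent w = some y ∧ Λ.lev w ≠ Λ.lev y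

open Classical in
/-- The highest ancestor that is reached without changing the level. The nodes with a common `top`
form a *component*. -/
noncomputable def top (w : F.Node) : F.Node :=
  F.fold (fun w o => match o with
    | none => w
    | some t => if Λ.lev w = Λ.lev t then t else w) w

open Classical in
/-- The component whose highest node is `t`. -/
noncomputable def comp (t : F.Node) : Finset F.Node := {y | Λ.top y = t}

open Classical in
/-- A distinguished child on the same level, if there is one. -/
noncomputable def first (y : F.Node) : Option F.Node :=
  if h : ∃ w, Λ.Same w y then some h.choose else none

/-- `w` is the distinguished child of its parent. -/
def IsFirst (w : F.Node) : Prop := ∃ y, Λ.Same w y ∧ Λ.first y = some w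

open Classical in
/-- The highest node of the chain of distinguished children through a node. -/
noncomputable def head (w : F.Node) : F.Node :=
  F.fold (fun w o => match o with
    | none => w
    | some t => if Λ.IsFirst w then t else w) w

open Classical in
/-- The vertices below `y` that are not below a child of `y` on the same level. -/
noncomputable def own (y : F.Node) : Finset V :=
  {v | F.Below (F.home v) y ∧ ∀ w, Λ.Same w y → ¬ F.Below (F.home v) w}

variable {Λ}

theorem mem_comp {t y : F.Node} : y ∈ Λ.comp t ↔ Λ.top y = t := by simp [comp]

theorem mem_own {y : F.Node} {v : V} :
    v ∈ Λ.own y ↔ F.Below (F.home v) y ∧ ∀ w, Λ.Same w y → ¬ F.Below (F.home v) w := by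
  simp [own]

theorem lev_le {x y : F.Node} (h : F.Below x y) : Λ.lev y ≤ Λ.lev x := by
  induction h with
  | refl => exact le_rfl
  | tail _ h ih => exact (Λ.mono _ _ h).trans ih

theorem top_spec (w : F.Node) : F.Below w (Λ.top w) ∧ Λ.lev (Λ.top w) = Λ.lev w := by
  induction hd : F.depth w using Nat.strong_induction_on generalizing w with
  | _ n ih =>
    rcases hp : F.parent w with _ | y
    · rw [top, fold_none _ hp]
      exact ⟨Below.refl _, rfl⟩
    · have h1 := F.depth_parent w y hp
      obtain ⟨h2, h3⟩ := ih (F.depth y) (by omega) y rfl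
      rw [top, fold_some _ hp]
      change F.Below w (if Λ.lev w = Λ.lev (Λ.top y) then Λ.top y else w) ∧
        Λ.lev (if Λ.lev w = Λ.lev (Λ.top y) then Λ.top y else w) = Λ.lev w
      split_ifs with h
      · exact ⟨(Below.parent hp).trans h2, h.symm⟩
      · exact ⟨Below.refl _, rfl⟩

theorem Same.top_eq {w y : F.Node} (h : Λ.Same w y) : Λ.top w = Λ.top y := by
  have h3 := (top_spec (Λ := Λ) y).2
  rw [top, fold_some _ h.1]
  change (if Λ.lev w = Λ.lev (Λ.top y) then Λ.top y else w) = Λ.top y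
  rw [if_pos (h.2.trans h3.symm)]

theorem Light.top_eq {w y : F.Node} (h : Λ.Light w y) : Λ.top w = w := by
  have h3 := (top_spec (Λ := Λ) y).2
  rw [top, fold_some _ h.1]
  change (if Λ.lev w = Λ.lev (Λ.top y) then Λ.top y else w) = w
  rw [if_neg fun h' => h.2 (h'.trans h3)]

theorem top_of_root {w : F.Node} (h : F.parent w = none) : Λ.top w = w := by
  rw [top, fold_none _ h]

/-- A node is a root, or on the level of its parent, or on a larger one. -/
theorem cases_parent (w : F.Node) :
    F.parent w = none ∨ (∃ y, Λ.Same w y) ∨ ∃ y, Λ.Light w y := by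
  rcases hp : F.parent w with _ | y
  · exact Or.inl rfl
  · by_cases h : Λ.lev w = Λ.lev y
    · exact Or.inr (Or.inl ⟨y, hp, h⟩)
    · exact Or.inr (Or.inr ⟨y, hp, h⟩)

theorem top_eq_of_below {x y : F.Node} (h : F.Below x y) (hl : Λ.lev x = Λ.lev y) :
    Λ.top x = Λ.top y := by
  induction h with
  | refl => rfl
  | @tail b c hb hc ih =>
    have h1 := lev_le (Λ := Λ) hb
    have h2 := Λ.mono _ _ hc
    rw [ih (by omega)]
    exact Same.top_eq ⟨hc, by omega⟩

theorem lev_eq_of_top {x y : F.Node} (h : Λ.top x = Λ.top y) : Λ.lev x = Λ.lev y := by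
  rw [← (top_spec x).2, ← (top_spec y).2, h]

theorem top_top (w : F.Node) : Λ.top (Λ.top w) = Λ.top w :=
  (top_eq_of_below (top_spec w).1 (top_spec w).2.symm).symm

theorem not_same_top (w y : F.Node) : ¬ Λ.Same (Λ.top w) y := by
  intro h
  have h1 := h.top_eq
  rw [top_top] at h1
  have h2 := (top_spec (Λ := Λ) y).1.depth_le
  have h3 := F.depth_parent _ _ h.1
  rw [← h1] at h2
  omega

/-- Going up inside a component, towards the home of a vertex of an upward adhesion. -/
theorem up_step_of_top {y : F.Node} {u : V} (hu : u ∈ F.up y)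
    (ht : Λ.top y = Λ.top (F.home u)) :
    ∃ x, Λ.Same y x ∧ (F.home u = x ∨ u ∈ F.up x) := by
  obtain ⟨x, hx, h⟩ := F.up_step y u hu
  have h1 : Λ.lev (F.home u) ≤ Λ.lev x := by
    rcases h with h | h
    · rw [h]
    · exact lev_le (below_home_of_mem_up h).1
  have h2 := lev_eq_of_top ht
  have h3 := Λ.mono _ _ hx
  exact ⟨x, ⟨hx, by omega⟩, h⟩

/-- If a vertex is in the upward adhesion of a node of its own component, it is also in that of a
child of its home on the same level. -/
theorem exists_child_of_home {y : F.Node} {u : V} (hu : u ∈ F.up y)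
    (ht : Λ.top y = Λ.top (F.home u)) :
    ∃ w, Λ.Same w (F.home u) ∧ u ∈ F.up w := by
  induction hd : F.depth y using Nat.strong_induction_on generalizing y with
  | _ n ih =>
    obtain ⟨x, hx, h⟩ := up_step_of_top hu ht
    rcases h with h | h
    · exact ⟨y, h ▸ hx, hu⟩
    · have := F.depth_parent _ _ hx.1
      exact ih (F.depth x) (by omega) h (hx.top_eq ▸ ht) rfl

theorem first_same {w y : F.Node} (h : Λ.first y = some w) : Λ.Same w y := by
  rw [first] at h
  split_ifs at h with h'
  rw [← Option.some.inj h]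
  exact h'.choose_spec

theorem exists_first {w y : F.Node} (h : Λ.Same w y) : ∃ z, Λ.first y = some z := by
  have h' : ∃ w, Λ.Same w y := ⟨w, h⟩
  exact ⟨_, by rw [first, dif_pos h']⟩

open Classical in
theorem head_of_isFirst {w y : F.Node} (hy : F.parent w = some y) (h : Λ.IsFirst w) :
    Λ.head w = Λ.head y := by
  rw [head, fold_some _ hy]
  change (if Λ.IsFirst w then Λ.head y else w) = Λ.head y
  rw [if_pos h]

open Classical in
theorem head_of_not_isFirst {w : F.Node} (h : ¬ Λ.IsFirst w) : Λ.head w = w := by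
  rcases hp : F.parent w with _ | y
  · rw [head, fold_none _ hp]
  · rw [head, fold_some _ hp]
    change (if Λ.IsFirst w then Λ.head y else w) = w
    rw [if_neg h]

theorem head_spec (w : F.Node) :
    ¬ Λ.IsFirst (Λ.head w) ∧ F.Below w (Λ.head w) ∧ Λ.top (Λ.head w) = Λ.top w := by
  induction hd : F.depth w using Nat.strong_induction_on generalizing w with
  | _ n ih =>
    by_cases h : Λ.IsFirst w
    · obtain ⟨y, hy, -⟩ := id h
      have h1 := F.depth_parent _ _ hy.1
      obtain ⟨h2, h3, h4⟩ := ih (F.depth y) (by omega) y rfl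
      rw [head_of_isFirst hy.1 h, hy.top_eq]
      exact ⟨h2, (Below.parent hy.1).trans h3, h4⟩
    · rw [head_of_not_isFirst h]
      exact ⟨h, Below.refl _, rfl⟩

theorem eq_of_head_depth {a b : F.Node} (h : Λ.head a = Λ.head b) (hd : F.depth a = F.depth b) :
    a = b := by
  induction hn : F.depth a using Nat.strong_induction_on generalizing a b with
  | _ n ih =>
    by_cases ha : Λ.IsFirst a
    · by_cases hb : Λ.IsFirst b
      · obtain ⟨x, hx, hxa⟩ := id ha
        obtain ⟨y, hy, hyb⟩ := id hb
        have h1 := F.depth_parent _ _ hx.1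
        have h2 := F.depth_parent _ _ hy.1
        rw [head_of_isFirst hx.1 ha, head_of_isFirst hy.1 hb] at h
        have := ih (F.depth x) (by omega) h (by omega) rfl
        subst this
        exact Option.some.inj (hxa.symm.trans hyb)
      · rw [head_of_not_isFirst hb] at h
        have := (head_spec (Λ := Λ) a).2.1
        rw [h] at this
        exact this.eq_of_depth hd.le
    · rw [head_of_not_isFirst ha] at h
      have := (head_spec (Λ := Λ) b).2.1
      rw [← h] at this
      exact (this.eq_of_depth hd.ge).symm

theorem home_mem_own (v : V) : v ∈ Λ.own (F.home v) := by
  rw [mem_own]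
  refine ⟨Below.refl _, fun w hw hb => ?_⟩
  have := hb.depth_le
  have := F.depth_parent _ _ hw.1
  omega

theorem own_nonempty (y : F.Node) : (Λ.own y).Nonempty := by
  obtain ⟨v, rfl⟩ := F.home_surjective y
  exact ⟨v, home_mem_own v⟩

theorem Light.desc_subset_own {w y : F.Node} (h : Λ.Light w y) : F.desc w ⊆ Λ.own y := by
  intro v hv
  rw [mem_desc] at hv
  rw [mem_own]
  refine ⟨hv.trans (Below.parent h.1), fun w' hw' hb => ?_⟩
  have h1 := F.depth_parent _ _ h.1
  have h2 := F.depth_parent _ _ hw'.1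
  have := hv.eq_of_depth_eq hb (by omega)
  subst this
  exact h.2 hw'.2

theorem disjoint_own {x y : F.Node} (ht : Λ.top x = Λ.top y) (h : x ≠ y) :
    Disjoint (Λ.own x) (Λ.own y) := by
  have key : ∀ {x y : F.Node} {v : V}, Λ.top x = Λ.top y → x ≠ y → v ∈ Λ.own x → v ∈ Λ.own y →
      ¬ F.Below x y := by
    intro x y v ht h hx hy hb
    rcases Relation.ReflTransGen.cases_tail hb with h' | ⟨w, hw, hwy⟩
    · exact h h'.symm
    · have h1 := lev_le (Λ := Λ) hw
      have h2 := Λ.mono _ _ hwy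
      have h3 := lev_eq_of_top ht
      exact (mem_own.1 hy).2 w ⟨hwy, by omega⟩ ((mem_own.1 hx).1.trans hw)
  rw [Finset.disjoint_left]
  intro v hx hy
  rcases (mem_own.1 hx).1.total (mem_own.1 hy).1 with hb | hb
  · exact key ht h hx hy hb
  · exact key ht.symm h.symm hy hx hb

variable (Λ) in
/-- The total weight of `Λ.own y`. -/
noncomputable def ownWeight (ω : V → ℝ) (y : F.Node) : ℝ := ∑ v ∈ Λ.own y, ω v

theorem ownWeight_pos {ω : V → ℝ} (hω : ∀ v, 0 < ω v) (y : F.Node) : 0 < Λ.ownWeight ω y :=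
  Finset.sum_pos (fun v _ => hω v) (own_nonempty y)

theorem sum_ownWeight_le {ω : V → ℝ} (hω : ∀ v, 0 < ω v) {t : F.Node} {S : Finset F.Node}
    (hS : S ⊆ Λ.comp t) : ∑ y ∈ S, Λ.ownWeight ω y ≤ F.weight ω t := by
  classical
  unfold ownWeight
  rw [← Finset.sum_biUnion]
  · refine Finset.sum_le_sum_of_subset_of_nonneg ?_ fun v _ _ => (hω v).le
    intro v hv
    obtain ⟨y, hy, hv⟩ := Finset.mem_biUnion.1 hv
    have := (top_spec (Λ := Λ) y).1
    rw [mem_comp.1 (hS hy)] at this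
    exact mem_desc.2 ((mem_own.1 hv).1.trans this)
  · intro x hx y hy hne
    exact disjoint_own ((mem_comp.1 (hS hx)).trans (mem_comp.1 (hS hy)).symm) hne

open Classical in
/-- A component whose nodes all have weight at least `β` is partitioned into at most
`weight t / β` chains of distinguished children, because the lowest nodes of these chains are
incomparable. -/
theorem card_heads_mul_le {ω : V → ℝ} (hω : ∀ v, 0 < ω v) {t : F.Node} {β : ℝ}
    (hβ : ∀ y ∈ Λ.comp t, β ≤ F.weight ω y) :
    (((Λ.comp t).filter fun w => ¬ Λ.IsFirst w).card : ℝ) * β ≤ F.weight ω t := by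
  rcases le_total β 0 with h0 | h0
  · exact (mul_nonpos_of_nonneg_of_nonpos (Nat.cast_nonneg _) h0).trans (weight_pos hω t).le
  set L := (Λ.comp t).filter fun y => ¬ ∃ w, Λ.Same w y with hL
  have hcard : ((Λ.comp t).filter fun w => ¬ Λ.IsFirst w).card ≤ L.card := by
    refine Finset.card_le_card_of_surjOn Λ.head ?_
    intro a ha
    obtain ⟨hat, haf⟩ := Finset.mem_filter.1 (Finset.mem_coe.1 ha)
    obtain ⟨y, hy, hmax⟩ := Finset.exists_max_image
      ((Λ.comp t).filter fun y => Λ.head y = a) F.depth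
      ⟨a, Finset.mem_filter.2 ⟨hat, head_of_not_isFirst haf⟩⟩
    obtain ⟨hyt, hya⟩ := Finset.mem_filter.1 hy
    refine ⟨y, Finset.mem_coe.2 (Finset.mem_filter.2 ⟨hyt, ?_⟩), hya⟩
    rintro ⟨w, hw⟩
    obtain ⟨z, hz⟩ := exists_first hw
    have hzy := first_same hz
    have h1 := hmax z (Finset.mem_filter.2 ⟨mem_comp.2 (hzy.top_eq.trans (mem_comp.1 hyt)), by
      rw [head_of_isFirst hzy.1 ⟨y, hzy, hz⟩, hya]⟩)
    have h2 := F.depth_parent _ _ hzy.1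
    omega
  calc (((Λ.comp t).filter fun w => ¬ Λ.IsFirst w).card : ℝ) * β
      ≤ L.card * β := by gcongr
    _ = ∑ y ∈ L, β := by simp
    _ ≤ ∑ y ∈ L, Λ.ownWeight ω y := by
        refine Finset.sum_le_sum fun y hy => ?_
        obtain ⟨hyt, hyl⟩ := Finset.mem_filter.1 hy
        refine (hβ y hyt).trans (le_of_eq ?_)
        unfold weight ownWeight
        congr 1
        ext v
        rw [mem_desc, mem_own]
        exact ⟨fun h => ⟨h, fun w hw => absurd ⟨w, hw⟩ hyl⟩, fun h => h.1⟩
    _ ≤ F.weight ω t := sum_ownWeight_le hω (Finset.filter_subset _ _)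

end Levelling

end Levelling

end AdhesionForest

/-! ### Identifying the vertices of an adhesion inside a component -/

/-- `Matches p a q b`: the identifier `a`, read at position `p`, is the identifier `b`, read at
position `q`. An identifier is either absolute (first string `[true]`) or relative to the first `d`
bits of the position (first string `false` followed by `d` in binary). -/
def Matches (p : List Bool) (a : List Bool × List Bool) (q : List Bool)
    (b : List Bool × List Bool) : Prop :=
  a = b ∧ (a.1 = [true] ∨ ∃ d : ℕ, a.1 = false :: d.bits ∧ p.take d = q.take d)

namespace AdhesionForest.Levelling

variable {V : Type} [Fintype V] {Gp : SimpleGraph V} {𝒢 : GraphClass} {k : ℕ}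
  {F : AdhesionForest Gp 𝒢 k} {Λ : F.Levelling}

/-- The nodes of a component whose bags contain a given vertex, if all of them but the home of the
vertex are distinguished children, form an interval of a chain of distinguished children. -/
theorem trace_convex {u : V}
    (hu : ∀ w, Λ.top w = Λ.top (F.home u) → u ∈ F.up w → Λ.IsFirst w) {a b c : F.Node}
    (ha : Λ.top a = Λ.top (F.home u) ∧ (a = F.home u ∨ u ∈ F.up a))
    (hb : Λ.top b = Λ.top (F.home u) ∧ (b = F.home u ∨ u ∈ F.up b))
    (hab : Λ.head a = Λ.head b) (hcb : Λ.head c = Λ.head b) (hac : F.depth a ≤ F.depth c)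
    (hcb' : F.depth c ≤ F.depth b) :
    Λ.top c = Λ.top (F.home u) ∧ (c = F.home u ∨ u ∈ F.up c) := by
  have hhome : F.depth (F.home u) ≤ F.depth a := by
    rcases ha.2 with h | h
    · rw [h]
    · exact (below_home_of_mem_up h).2.le
  induction hn : F.depth b using Nat.strong_induction_on generalizing b with
  | _ n ih =>
    by_cases hd : F.depth c = F.depth b
    · rw [eq_of_head_depth hcb hd]
      exact hb
    · rcases hb.2 with h | h
      · rw [h] at hcb' hd; omega
      · obtain ⟨x, hx, hx'⟩ := up_step_of_top h hb.1
        have h1 := head_of_isFirst hx.1 (hu b hb.1 h)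
        have h2 := F.depth_parent _ _ hx.1
        exact ih (F.depth x) (by omega) ⟨hx.top_eq ▸ hb.1, hx'.imp_left Eq.symm⟩ (hab.trans h1)
          (hcb.trans h1) (by omega) rfl

theorem head_eq_of_trace {u : V}
    (hu : ∀ w, Λ.top w = Λ.top (F.home u) → u ∈ F.up w → Λ.IsFirst w) {a : F.Node}
    (ha : Λ.top a = Λ.top (F.home u) ∧ (a = F.home u ∨ u ∈ F.up a)) :
    Λ.head a = Λ.head (F.home u) := by
  induction hn : F.depth a using Nat.strong_induction_on generalizing a with
  | _ n ih =>
    rcases ha.2 with h | h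
    · rw [h]
    · obtain ⟨x, hx, hx'⟩ := up_step_of_top h ha.1
      have h2 := F.depth_parent _ _ hx.1
      rw [head_of_isFirst hx.1 (hu a ha.1 h)]
      exact ih (F.depth x) (by omega) ⟨hx.top_eq ▸ ha.1, hx'.imp_left Eq.symm⟩ rfl

open Classical in
/-- Positions for the nodes of a component and identifiers for the vertices that live in it, such
that the position of a node and the identifier of a vertex `u` of its upward adhesion determine `u`.

The identifier is absolute for the at most `k h` vertices in the upward adhesion of a node that is
not a distinguished child. The trace of any other vertex is an interval of a chain of distinguished
children; it has a centre `b` in the search tree of the positions, and the vertex is determined by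
`b` and one of `2 k` colours. -/
theorem exists_identifiers {ω : V → ℝ} (hω : ∀ v, 0 < ω v) (t : F.Node) {h : ℝ} (h1 : 1 ≤ h)
    (hh : (((Λ.comp t).filter fun w => ¬ Λ.IsFirst w).card : ℝ) ≤ h) :
    ∃ (pos : F.Node → List Bool) (tag : V → List Bool × List Bool),
      (∀ x y, Λ.top x = t → Λ.top y = t → pos x = pos y → x = y) ∧
      (∀ y, Λ.top y = t → ((pos y).length : ℝ) ≤
        Real.logb 2 (F.weight ω t) - Real.logb 2 (Λ.ownWeight ω y)) ∧
      (∀ v, Λ.top (F.home v) = t → (tag v).1.length ≤ (pos (F.home v)).length.size + 1 ∧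
        ((tag v).2.length : ℝ) ≤ Real.logb 2 (2 * (k + 1) * h)) ∧
      ∀ y u v, Λ.top y = t → u ∈ F.up y → Λ.top (F.home u) = t → Λ.top (F.home v) = t →
        (Matches (pos y) (tag u) (pos (F.home v)) (tag v) ↔ u = v) := by
  let _ : LinearOrder F.Node := linearOrderOfSTO (WellOrderingRel (α := F.Node))
  let key : F.Node → Lex (F.Node × ℕ) := fun y => toLex (Λ.head y, F.depth y)
  have hkey : Function.Injective key := by
    intro a b hab
    have := Prod.ext_iff.1 (toLex.injective hab)
    exact eq_of_head_depth this.1 this.2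
  obtain ⟨pos, hpos1, hpos2, hpos3⟩ := exists_searchPath key (Λ.comp t) hkey.injOn
    (Λ.ownWeight ω) fun y _ => ownWeight_pos hω y
  have hlog : ∀ y, Λ.top y = t → ((pos y).length : ℝ) ≤
      Real.logb 2 (F.weight ω t) - Real.logb 2 (Λ.ownWeight ω y) := by
    intro y hy
    refine (hpos2 y (mem_comp.2 hy)).trans (sub_le_sub_right ?_ _)
    exact Real.logb_le_logb_of_le (by norm_num)
      (Finset.sum_pos (fun y _ => ownWeight_pos hω y) ⟨y, mem_comp.2 hy⟩)
      (sum_ownWeight_le hω subset_rfl)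
  have hpos1' : ∀ x y, Λ.top x = t → Λ.top y = t → pos x = pos y → x = y := fun x y hx hy =>
    hpos1 (Finset.mem_coe.2 (mem_comp.2 hx)) (Finset.mem_coe.2 (mem_comp.2 hy))
  have hk0 : (0 : ℝ) ≤ k := Nat.cast_nonneg k
  -- absolute identifiers
  set C : Finset V := ((Λ.comp t).filter fun w => ¬ Λ.IsFirst w).biUnion F.up with hC
  have hCcard : (C.card : ℝ) ≤ 2 * (k + 1) * h := by
    have : (C.card : ℝ) ≤ ((Λ.comp t).filter fun w => ¬ Λ.IsFirst w).card * k := by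
      exact_mod_cast Finset.card_biUnion_le_card_mul _ _ k fun w _ => F.card_up w
    nlinarith [mul_le_mul_of_nonneg_right hh hk0]
  obtain ⟨num, hnum1, hnum2⟩ := exists_code C
  -- relative identifiers
  have hcentre : ∀ u, ∃ b, Λ.top (F.home u) = t → u ∉ C →
      (Λ.top b = t ∧ (b = F.home u ∨ u ∈ F.up b)) ∧
      ∀ y, Λ.top y = t → (y = F.home u ∨ u ∈ F.up y) → pos b <+: pos y := by
    intro u
    by_cases hu : Λ.top (F.home u) = t ∧ u ∉ C
    · obtain ⟨hut, huC⟩ := hu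
      have hfirst : ∀ w, Λ.top w = Λ.top (F.home u) → u ∈ F.up w → Λ.IsFirst w := by
        intro w hw huw
        by_contra hc
        exact huC (Finset.mem_biUnion.2
          ⟨w, Finset.mem_filter.2 ⟨mem_comp.2 (hw.trans hut), hc⟩, huw⟩)
      obtain ⟨b, hb, hb'⟩ := hpos3
        {y | Λ.top y = Λ.top (F.home u) ∧ (y = F.home u ∨ u ∈ F.up y)}
        (fun y hy => Finset.mem_coe.2 (mem_comp.2 (hy.1.trans hut)))
        ⟨F.home u, rfl, Or.inl rfl⟩ (by
          intro a ha b hb c _ hac hcb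
          have h1 := head_eq_of_trace hfirst ha
          have h2 := head_eq_of_trace hfirst hb
          rw [Prod.Lex.toLex_le_toLex] at hac hcb
          dsimp only at hac hcb
          have h3 : Λ.head c = Λ.head b := by
            rcases hcb with h | h
            · rcases hac with h' | h'
              · exact absurd (h'.trans h) (by rw [h1, h2]; exact lt_irrefl _)
              · rw [← h'.1, h1, h2]
            · exact h.1
          rw [h3] at hac hcb
          rw [h1, h2] at hac
          rw [h2] at hcb
          exact trace_convex hfirst ha hb (h1.trans h2.symm) h3
            (by simpa using hac) (by simpa using hcb))
      exact ⟨b, fun _ _ => ⟨⟨hb.1.trans hut, hb.2⟩, fun y hy hy' => hb' y ⟨hy.trans hut.symm, hy'⟩⟩⟩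
    · exact ⟨F.home u, fun h1 h2 => absurd ⟨h1, h2⟩ hu⟩
  choose centre hcentre using hcentre
  let P : F.Node → Finset V := fun b => F.up b ∪ (Λ.first b).elim ∅ F.up
  have hPcard : ∀ b, ((P b).card : ℝ) ≤ 2 * (k + 1) * h := by
    intro b
    have h2 : ((Λ.first b).elim ∅ F.up).card ≤ k := by
      cases Λ.first b with
      | none => simp
      | some w => exact F.card_up w
    have : (P b).card ≤ k + k := (Finset.card_union_le _ _).trans (add_le_add (F.card_up b) h2)
    have : ((P b).card : ℝ) ≤ k + k := by exact_mod_cast this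
    nlinarith
  have hP : ∀ u y, Λ.top (F.home u) = t → u ∉ C → Λ.top y = t → u ∈ F.up y →
      u ∈ P (centre u) := by
    intro u y hut huC hy huy
    rcases (hcentre u hut huC).1 with ⟨-, h | h⟩
    · obtain ⟨w, hw, huw⟩ := exists_child_of_home huy (hy.trans hut.symm)
      have hwt : Λ.top w = t := hw.top_eq.trans hut
      have hwf : Λ.IsFirst w := by
        by_contra hc
        exact huC (Finset.mem_biUnion.2 ⟨w, Finset.mem_filter.2 ⟨mem_comp.2 hwt, hc⟩, huw⟩)
      obtain ⟨x, hx, hxw⟩ := hwf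
      have hxu : x = F.home u := Option.some.inj (hx.1.symm.trans hw.1)
      refine Finset.mem_union_right _ ?_
      rw [h, ← hxu, hxw]
      exact huw
    · exact Finset.mem_union_left _ h
  choose col hcol1 hcol2 using fun b => exists_code (P b)
  let tag : V → List Bool × List Bool := fun u =>
    if u ∈ C then ([true], num u) else
    if u ∈ P (centre u) then (false :: (pos (centre u)).length.bits, col (centre u) u) else ([], [])
  have hkh : 0 ≤ Real.logb 2 (2 * (k + 1) * h) := Real.logb_nonneg (by norm_num) (by nlinarith)
  have hcards : ∀ (S : Finset V) (u : V), u ∈ S → (S.card : ℝ) ≤ 2 * (k + 1) * h →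
      Real.logb 2 S.card ≤ Real.logb 2 (2 * (k + 1) * h) := by
    intro S u hu hS
    exact Real.logb_le_logb_of_le (by norm_num)
      (by exact_mod_cast Finset.card_pos.2 ⟨u, hu⟩) hS
  refine ⟨pos, tag, hpos1', hlog, ?_, ?_⟩
  · intro v hv
    simp only [tag]
    split_ifs with h2 h3
    · exact ⟨by simp, (hnum2 v h2).trans (hcards _ v h2 hCcard)⟩
    · refine ⟨?_, (hcol2 _ v h3).trans (hcards _ v h3 (hPcard _))⟩
      rw [List.length_cons, Nat.size_eq_bits_len]
      have := ((hcentre v hv h2).2 _ hv (Or.inl rfl)).length_le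
      exact Nat.succ_le_succ (Nat.size_le_size this)
    · simpa using hkh
  · intro y u v hy huy hu hv
    constructor
    · rintro ⟨he, hm⟩
      by_cases huC : u ∈ C
      · have htu : tag u = ([true], num u) := by simp [tag, huC]
        by_cases hvC : v ∈ C
        · have htv : tag v = ([true], num v) := by simp [tag, hvC]
          rw [htu, htv] at he
          exact hnum1 huC hvC (Prod.ext_iff.1 he).2
        · rw [htu] at he
          simp only [tag, if_neg hvC] at he
          split_ifs at he <;> simp at he
      · have huP := hP u y hu huC hy huy
        have htu : tag u = (false :: (pos (centre u)).length.bits, col (centre u) u) := by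
          simp [tag, huC, huP]
        rw [htu] at he hm
        simp only [List.cons.injEq, Bool.false_eq_true, false_and, false_or,
          true_and] at hm
        obtain ⟨d, hd, htake⟩ := hm
        have hd := bits_injective hd
        by_cases hvC : v ∈ C
        · simp [tag, hvC] at he
        by_cases hvP : v ∈ P (centre v)
        · have htv : tag v = (false :: (pos (centre v)).length.bits, col (centre v) v) := by
            simp [tag, hvC, hvP]
          rw [htv] at he
          simp only [Prod.mk.injEq, List.cons.injEq, true_and] at he
          have hd' := bits_injective he.1
          have h2 := (hcentre u hu huC).2 y hy (Or.inr huy)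
          have h3 := (hcentre v hv hvC).2 _ hv (Or.inl rfl)
          rw [List.prefix_iff_eq_take] at h2 h3
          rw [← hd, ← h2, hd', ← h3] at htake
          have hc := hpos1' _ _ (hcentre u hu huC).1.1 (hcentre v hv hvC).1.1 htake
          rw [hc] at huP he
          exact hcol1 _ huP hvP he.2
        · simp [tag, hvC, hvP] at he
    · rintro rfl
      refine ⟨rfl, ?_⟩
      by_cases huC : u ∈ C
      · exact Or.inl (by simp [tag, huC])
      · have huP := hP u y hu huC hy huy
        refine Or.inr ⟨(pos (centre u)).length, by simp [tag, huC, huP], ?_⟩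
        have h2 := (hcentre u hu huC).2 y hy (Or.inr huy)
        have h3 := (hcentre u hu huC).2 _ hu (Or.inl rfl)
        rw [List.prefix_iff_eq_take] at h2 h3
        rw [← h2, ← h3]

end AdhesionForest.Levelling

/-! ### Addresses and pointers -/

/-- `Hits I B p C q a l`: the pointer `p`, read relative to the address `B`, points to the vertex
whose component has the address `C`, whose home has the position `q` in it, and which has the
identifier `a` and the local label `l`. The first string of `p` is a number `i`; the address `C` has
to consist of the first `i` entries of `B`, and the entry at index `i` holds a position and a clique
label, against which the other two strings of `p` are read. -/
def Hits (I : List Bool → List Bool → List Bool → Bool)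
    (B : List (List Bool × List Bool × List Bool)) (p : List Bool × List Bool × List Bool)
    (C : List (List Bool × List Bool × List Bool)) (q : List Bool) (a : List Bool × List Bool)
    (l : List Bool) : Prop :=
  ∃ (i : ℕ) (s r m : List Bool), p.1 = i.bits ∧ B.take i = C ∧ B[i]? = some (s, r, m) ∧
    ((∃ x, p.2.1 = true :: x ∧ Matches r (x, p.2.2) q a) ∨
      (p.2.1 = [] ∧ r = q ∧ I m p.2.2 l = true))

theorem hits_append {I : List Bool → List Bool → List Bool → Bool}
    {B C R : List (List Bool × List Bool × List Bool)} {s r m x y q l : List Bool}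
    {a : List Bool × List Bool} :
    Hits I (B ++ (s, r, m) :: R) (B.length.bits, x, y) C q a l ↔
      B = C ∧ ((∃ z, x = true :: z ∧ Matches r (z, y) q a) ∨ (x = [] ∧ r = q ∧ I m y l = true)) := by
  constructor
  · rintro ⟨i, s', r', m', hi, htake, hget, h⟩
    have hi := bits_injective hi
    subst hi
    simp only [List.take_left', List.getElem?_append_right le_rfl, Nat.sub_self,
      List.getElem?_cons_zero, Option.some.injEq, Prod.mk.injEq] at htake hget
    obtain ⟨rfl, rfl, rfl⟩ := hget
    exact ⟨htake, h⟩
  · rintro ⟨rfl, h⟩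
    exact ⟨B.length, s, r, m, rfl, by simp, by simp, h⟩

namespace AdhesionForest.Levelling

variable {V : Type} [Fintype V] {Gp : SimpleGraph V} {𝒢 : GraphClass} {k : ℕ}
  {F : AdhesionForest Gp 𝒢 k}

/-- The strings from which labels are composed: positions `pos` of nodes in their components,
identifiers `tag` and local labels `lab` of vertices, labels `loc` of the part of the upward
adhesion of a node that lives at its parent, with the strings `key` that identify its elements, and
strings `sib` that distinguish siblings with the same `loc`. -/
structure Code (Λ : F.Levelling) (I : List Bool → List Bool → List Bool → Bool) where
  pos : F.Node → List Bool
  sib : F.Node → List Bool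
  loc : F.Node → List Bool
  tag : V → List Bool × List Bool
  lab : V → List Bool
  key : F.Node → V → List Bool
  pos_inj : ∀ x y, Λ.top x = Λ.top y → pos x = pos y → x = y
  sib_inj : ∀ x y, F.parent x = F.parent y → Λ.top x = x → Λ.top y = y → sib x = sib y →
    loc x = loc y → x = y
  tag_spec : ∀ y u v, u ∈ F.up y → Λ.top (F.home u) = Λ.top y → Λ.top (F.home v) = Λ.top y →
    (Matches (pos y) (tag u) (pos (F.home v)) (tag v) ↔ u = v)
  key_spec : ∀ w y u v, F.parent w = some y → u ∈ F.up w → F.home u = y → F.home v = y →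
    (I (loc w) (key w u) (lab v) = true ↔ u = v)

/-- A vertex of an upward adhesion that lives outside the component is in the upward adhesion of
the component. -/
theorem mem_up_top {Λ : F.Levelling} {y : F.Node} {u : V} (hu : u ∈ F.up y)
    (h : Λ.top (F.home u) ≠ Λ.top y) : u ∈ F.up (Λ.top y) := by
  induction hn : F.depth y using Nat.strong_induction_on generalizing y with
  | _ n ih =>
    obtain ⟨x, hx, hxu⟩ := F.up_step y u hu
    by_cases hs : Λ.lev y = Λ.lev x
    · have hs : Λ.Same y x := ⟨hx, hs⟩
      have := F.depth_parent _ _ hx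
      rw [hs.top_eq] at h ⊢
      rcases hxu with hxu | hxu
      · exact absurd (by rw [hxu]) h
      · exact ih (F.depth x) (by omega) hxu h rfl
    · have hl : Λ.Light y x := ⟨hx, hs⟩
      rwa [hl.top_eq]

namespace Code

variable {Λ : F.Levelling} {I : List Bool → List Bool → List Bool → Bool} (S : Λ.Code I)

open Classical in
/-- The address of the component of a node: one entry for each of the components that are passed on
the way down from the root. -/
noncomputable def chain (w : F.Node) : List (List Bool × List Bool × List Bool) :=
  F.fold (fun w o => match o with
    | none => [(S.sib w, [], S.loc w)]
    | some l => if ∃ y, Λ.Same w y then l else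
        l ++ [(S.sib w, (F.parent w).elim [] S.pos, S.loc w)]) w

variable {S}

theorem chain_root {w : F.Node} (h : F.parent w = none) :
    S.chain w = [(S.sib w, [], S.loc w)] := by
  rw [chain, fold_none _ h]

open Classical in
theorem chain_same {w y : F.Node} (h : Λ.Same w y) : S.chain w = S.chain y := by
  rw [chain, fold_some _ h.1]
  change (if ∃ y, Λ.Same w y then S.chain y else _) = _
  rw [if_pos ⟨y, h⟩]

open Classical in
theorem chain_light {w y : F.Node} (h : Λ.Light w y) :
    S.chain w = S.chain y ++ [(S.sib w, S.pos y, S.loc w)] := by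
  rw [chain, fold_some _ h.1]
  change (if ∃ y, Λ.Same w y then S.chain y else
    S.chain y ++ [(S.sib w, (F.parent w).elim [] S.pos, S.loc w)]) = _
  rw [if_neg, h.1]
  · rfl
  · rintro ⟨z, hz⟩
    have : z = y := Option.some.inj (hz.1.symm.trans h.1)
    exact h.2 (this ▸ hz.2)

theorem chain_ne_nil (w : F.Node) : S.chain w ≠ [] := by
  induction hn : F.depth w using Nat.strong_induction_on generalizing w with
  | _ n ih =>
    rcases cases_parent (Λ := Λ) w with h | ⟨y, h⟩ | ⟨y, h⟩
    · simp [chain_root h]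
    · have := F.depth_parent _ _ h.1
      rw [chain_same h]
      exact ih (F.depth y) (by omega) y rfl
    · simp [chain_light h]

theorem chain_top (w : F.Node) : S.chain (Λ.top w) = S.chain w := by
  induction hn : F.depth w using Nat.strong_induction_on generalizing w with
  | _ n ih =>
    rcases cases_parent (Λ := Λ) w with h | ⟨y, h⟩ | ⟨y, h⟩
    · rw [top_of_root h]
    · have := F.depth_parent _ _ h.1
      rw [chain_same h, h.top_eq]
      exact ih (F.depth y) (by omega) y rfl
    · rw [h.top_eq]

theorem length_chain_le (w : F.Node) : (S.chain w).length ≤ Λ.lev w + 1 := by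
  induction hn : F.depth w using Nat.strong_induction_on generalizing w with
  | _ n ih =>
    rcases cases_parent (Λ := Λ) w with h | ⟨y, h⟩ | ⟨y, h⟩
    · simp [chain_root h]
    · have := F.depth_parent _ _ h.1
      rw [chain_same h, h.2]
      exact ih (F.depth y) (by omega) y rfl
    · have := F.depth_parent _ _ h.1
      have h1 := ih (F.depth y) (by omega) y rfl
      have h2 := Λ.mono _ _ h.1
      have h3 := h.2
      rw [chain_light h, List.length_append, List.length_singleton]
      omega

theorem top_eq_of_chain {x y : F.Node} (h : S.chain x = S.chain y) : Λ.top x = Λ.top y := by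
  induction hn : F.depth x + F.depth y using Nat.strong_induction_on generalizing x y with
  | _ n ih =>
    rcases cases_parent (Λ := Λ) x with hx | ⟨x', hx⟩ | ⟨x', hx⟩
    · rcases cases_parent (Λ := Λ) y with hy | ⟨y', hy⟩ | ⟨y', hy⟩
      · rw [chain_root hx, chain_root hy] at h
        simp only [List.cons.injEq, Prod.mk.injEq, true_and, and_true] at h
        rw [S.sib_inj x y (hx.trans hy.symm) (top_of_root hx) (top_of_root hy) h.1 h.2]
      · have := F.depth_parent _ _ hy.1
        rw [hy.top_eq]
        exact ih (F.depth x + F.depth y') (by omega) (h.trans (chain_same hy)) rfl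
      · rw [chain_root hx, chain_light hy] at h
        have h1 := congrArg List.length h
        have h2 := List.length_pos_of_ne_nil (chain_ne_nil (S := S) y')
        simp only [List.length_append, List.length_singleton] at h1
        omega
    · have := F.depth_parent _ _ hx.1
      rw [hx.top_eq]
      exact ih (F.depth x' + F.depth y) (by omega) ((chain_same hx).symm.trans h) rfl
    · rcases cases_parent (Λ := Λ) y with hy | ⟨y', hy⟩ | ⟨y', hy⟩
      · rw [chain_root hy, chain_light hx] at h
        have h1 := congrArg List.length h
        have h2 := List.length_pos_of_ne_nil (chain_ne_nil (S := S) x')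
        simp only [List.length_append, List.length_singleton] at h1
        omega
      · have := F.depth_parent _ _ hy.1
        rw [hy.top_eq]
        exact ih (F.depth x + F.depth y') (by omega) (h.trans (chain_same hy)) rfl
      · have := F.depth_parent _ _ hx.1
        have := F.depth_parent _ _ hy.1
        rw [chain_light hx, chain_light hy] at h
        obtain ⟨h1, h2⟩ := List.append_inj' h rfl
        simp only [List.cons.injEq, Prod.mk.injEq, and_true] at h2
        obtain ⟨h2, h3, h4⟩ := h2
        have h5 := S.pos_inj _ _ (ih (F.depth x' + F.depth y') (by omega) h1 rfl) h3
        rw [S.sib_inj x y (by rw [hx.1, hy.1, h5]) hx.top_eq hy.top_eq h2 h4]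

theorem eq_of_chain_pos {x y : F.Node} (h : S.chain x = S.chain y) (h' : S.pos x = S.pos y) :
    x = y :=
  S.pos_inj _ _ (top_eq_of_chain h) h'

variable (S) in
/-- The pointer `p`, read relative to the address `B`, points to `v`. -/
def PointsTo (B : List (List Bool × List Bool × List Bool))
    (p : List Bool × List Bool × List Bool) (v : V) : Prop :=
  Hits I B p (S.chain (F.home v)) (S.pos (F.home v)) (S.tag v) (S.lab v)

/-- Every vertex `u` of an upward adhesion can be pointed to. If `u` lives in the component of the
node, its identifier serves; otherwise `u` lives in a component further up, which is left through a
light child, and `u` either lives at the parent of that child or is in the upward adhesion of that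
parent. -/
theorem exists_pointer {y : F.Node} {u : V} (hu : u ∈ F.up y) :
    ∃ p : List Bool × List Bool × List Bool,
      (∃ i, i ≤ (S.chain y).length ∧ p.1 = i.bits) ∧
      (p.2 = (true :: (S.tag u).1, (S.tag u).2) ∨
        ∃ w, F.parent w = some (F.home u) ∧ u ∈ F.up w ∧ p.2 = ([], S.key w u)) ∧
      ∀ s m R v, S.PointsTo (S.chain y ++ (s, S.pos y, m) :: R) p v ↔ u = v := by
  induction hn : F.depth y using Nat.strong_induction_on generalizing y with
  | _ n ih =>
    by_cases ht : Λ.top (F.home u) = Λ.top y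
    · refine ⟨((S.chain y).length.bits, true :: (S.tag u).1, (S.tag u).2), ⟨_, le_rfl, rfl⟩,
        Or.inl rfl, ?_⟩
      intro s m R v
      rw [PointsTo, hits_append]
      constructor
      · rintro ⟨h1, ⟨z, hz, h2⟩ | ⟨h2, -⟩⟩
        · rw [← (List.cons.inj hz).2] at h2
          exact (S.tag_spec y u v hu ht (top_eq_of_chain h1).symm).1 h2
        · simp at h2
      · rintro rfl
        refine ⟨?_, Or.inl ⟨_, rfl, (S.tag_spec y u u hu ht ht).2 rfl⟩⟩
        rw [← chain_top y, ← ht, chain_top]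
    · have hut := mem_up_top hu ht
      rcases cases_parent (Λ := Λ) (Λ.top y) with h | ⟨x, h⟩ | ⟨x, h⟩
      · obtain ⟨x, hx, -⟩ := F.up_step _ u hut
        rw [h] at hx; cases hx
      · exact absurd h (not_same_top y x)
      · obtain ⟨x', hx', hxu⟩ := F.up_step _ u hut
        have hxx : x' = x := Option.some.inj (hx'.symm.trans h.1)
        subst hxx
        have hchain : S.chain y = S.chain x' ++ [(S.sib (Λ.top y), S.pos x', S.loc (Λ.top y))] := by
          rw [← chain_top y, chain_light h]
        have hd := (top_spec (Λ := Λ) y).1.depth_le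
        have hd' := F.depth_parent _ _ hx'
        rcases hxu with hxu | hxu
        · refine ⟨((S.chain x').length.bits, [], S.key (Λ.top y) u),
            ⟨_, by simp [hchain], rfl⟩, Or.inr ⟨_, hxu ▸ hx', hut, rfl⟩, ?_⟩
          intro s m R v
          rw [hchain, List.append_assoc, List.singleton_append, PointsTo, hits_append]
          constructor
          · rintro ⟨h1, ⟨z, hz, -⟩ | ⟨-, h2, h3⟩⟩
            · simp at hz
            · exact (S.key_spec _ _ u v hx' hut hxu (eq_of_chain_pos h1 h2).symm).1 h3
          · rintro rfl
            exact ⟨by rw [hxu], Or.inr ⟨rfl, by rw [hxu], (S.key_spec _ _ u u hx' hut hxu hxu).2 rfl⟩⟩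
        · obtain ⟨p, ⟨i, hi, hp⟩, hp', hp''⟩ := ih (F.depth x') (by omega) hxu rfl
          refine ⟨p, ⟨i, ?_, hp⟩, hp', ?_⟩
          · rw [hchain, List.length_append]; omega
          · intro s m R v
            rw [hchain, List.append_assoc, List.singleton_append]
            exact hp'' _ _ _ v

end Code

end AdhesionForest.Levelling

/-! ### Choosing the strings -/

namespace AdhesionForest

variable {V : Type} [Fintype V] {Gp : SimpleGraph V} {𝒢 : GraphClass} {k : ℕ}
  {F : AdhesionForest Gp 𝒢 k}

variable (F) in
/-- The elements of `Q` that live at `y` form a clique of the torso of `y`. -/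
def IsLocalClique (y : F.Node) (Q : Finset V) : Prop :=
  (∃ u ∈ Q, F.home u = y) ∧ ∀ u v : {v // F.home v = y}, u.1 ∈ Q → v.1 ∈ Q → u ≠ v →
    (F.torso y).Adj u v

theorem isLocalClique_up {w y : F.Node} (h : F.parent w = some y) :
    F.IsLocalClique y (F.up w) :=
  ⟨F.up_home w y h, F.torso_of_up w y h⟩

open Classical in
/-- A labelling of the torso of one node, rephrased in terms of the vertices of the whole graph. -/
theorem exists_local_labelling {A : List Bool → List Bool → Bool}
    {I : List Bool → List Bool → List Bool → Bool} {c₁ c₂ c₃ : ℝ} {G : SimpleGraph V} (y : F.Node)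
    (hloc : ∀ θ : {v // F.home v = y} → ℝ, (∀ v, 0 < θ v) → ∃ μ κ,
      IsWeightedMixedLabelling A I c₁ c₂ c₃ (F.torso y) (G.comap Subtype.val) θ μ κ)
    (θ : V → ℝ) (hθ : ∀ v, 0 < θ v) :
    ∃ (lab : V → List Bool) (cl : Finset V → List Bool) (ky : Finset V → V → List Bool),
      (∀ u v, F.home u = y → F.home v = y → lab u = lab v → u = v) ∧
      (∀ u v, F.home u = y → F.home v = y → (A (lab u) (lab v) = true ↔ G.Adj u v)) ∧
      (∀ v, F.home v = y → ((lab v).length : ℝ) ≤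
        Real.logb 2 (∑ x with F.home x = y, θ x) - Real.logb 2 (θ v) + c₁) ∧
      (∀ Q Q', F.IsLocalClique y Q → F.IsLocalClique y Q' → cl Q = cl Q' →
        ∀ u, F.home u = y → (u ∈ Q ↔ u ∈ Q')) ∧
      (∀ Q u v, F.IsLocalClique y Q → u ∈ Q → F.home u = y → F.home v = y →
        ((I (cl Q) (ky Q u) (lab v) = true ↔ u = v) ∧ ((ky Q u).length : ℝ) ≤ c₂)) ∧
      ∀ Q, F.IsLocalClique y Q → ∃ u ∈ Q, F.home u = y ∧ ((cl Q).length : ℝ) ≤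
        Real.logb 2 (∑ x with F.home x = y, θ x) - Real.logb 2 (θ u) + c₃ := by
  obtain ⟨μ, κ, h⟩ := hloc (fun v => θ v) fun v => hθ v
  have hsum : ∑ x : {v // F.home v = y}, θ x = ∑ x with F.home x = y, θ x := by
    rw [Finset.sum_subtype (Finset.univ.filter fun x => F.home x = y) (p := fun x => F.home x = y)
      (by simp)]
  let toClique : ∀ Q, F.IsLocalClique y Q → CliqueOf (F.torso y) := fun Q hQ =>
    ⟨Q.subtype fun v => F.home v = y, by
      obtain ⟨u, hu, huy⟩ := hQ.1
      exact ⟨⟨u, huy⟩, by simpa using hu⟩, by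
      intro u hu v hv huv
      exact hQ.2 u v (by simpa using hu) (by simpa using hv) huv⟩
  have hmem : ∀ Q hQ (u : {v // F.home v = y}), u ∈ (toClique Q hQ).1 ↔ u.1 ∈ Q := by
    intro Q hQ u
    simp [toClique]
  refine ⟨fun v => if hv : F.home v = y then μ (Sum.inl ⟨v, hv⟩) else [],
    fun Q => if hQ : F.IsLocalClique y Q then μ (Sum.inr (toClique Q hQ)) else [],
    fun Q v => if hQ : F.IsLocalClique y Q ∧ F.home v = y then
      κ (toClique Q hQ.1) ⟨v, hQ.2⟩ else [], ?_, ?_, ?_, ?_, ?_, ?_⟩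
  · intro u v hu hv huv
    beta_reduce at huv
    rw [dif_pos hu, dif_pos hv] at huv
    exact congrArg Subtype.val (Sum.inl_injective (h.injective huv))
  · intro u v hu hv
    beta_reduce
    rw [dif_pos hu, dif_pos hv]
    exact h.adjacency _ _
  · intro v hv
    beta_reduce
    rw [dif_pos hv, ← hsum]
    exact h.length_vertex _
  · intro Q Q' hQ hQ' he u hu
    beta_reduce at he
    rw [dif_pos hQ, dif_pos hQ'] at he
    have he := Sum.inr_injective (h.injective he)
    rw [← hmem Q hQ ⟨u, hu⟩, he, hmem Q' hQ']
  · intro Q u v hQ huQ hu hv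
    beta_reduce
    rw [dif_pos hQ, dif_pos ⟨hQ, hu⟩, dif_pos hv]
    have huQ' : (⟨u, hu⟩ : {v // F.home v = y}) ∈ (toClique Q hQ).1 := (hmem Q hQ _).2 huQ
    refine ⟨?_, h.length_local _ _ huQ'⟩
    rw [h.identity _ _ _ huQ', Subtype.mk.injEq]
  · intro Q hQ
    have h1 := h.length_clique (toClique Q hQ)
    obtain ⟨u, hu, hmin⟩ := Finset.exists_mem_eq_inf' (toClique Q hQ).2.1
      (fun v : {v // F.home v = y} => θ v)
    rw [hmin, hsum] at h1
    refine ⟨u.1, (hmem Q hQ u).1 hu, u.2, ?_⟩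
    beta_reduce
    rw [dif_pos hQ]
    exact h1

namespace Levelling

variable {Λ : F.Levelling}

open Classical in
theorem sum_light_weight_le {ω : V → ℝ} (hω : ∀ v, 0 < ω v) (y : F.Node) :
    ∑ w with Λ.Light w y, F.weight ω w ≤ Λ.ownWeight ω y := by
  unfold weight ownWeight
  rw [← Finset.sum_biUnion]
  · refine Finset.sum_le_sum_of_subset_of_nonneg ?_ fun v _ _ => (hω v).le
    intro v hv
    obtain ⟨w, hw, hv⟩ := Finset.mem_biUnion.1 hv
    exact (Finset.mem_filter.1 hw).2.desc_subset_own hv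
  · intro w hw w' hw' hne
    have h1 := F.depth_parent _ _ (Finset.mem_filter.1 (Finset.mem_coe.1 hw)).2.1
    have h2 := F.depth_parent _ _ (Finset.mem_filter.1 (Finset.mem_coe.1 hw')).2.1
    exact disjoint_desc (h1.trans h2.symm) hne

variable (Λ) in
open Classical in
/-- The weight of a vertex in the torso of its home `y`: its own weight and the weights of all light
children of `y` whose upward adhesions contain it. -/
noncomputable def torsoWeight (ω : V → ℝ) (y : F.Node) (u : V) : ℝ :=
  ω u + ∑ w with Λ.Light w y ∧ u ∈ F.up w, F.weight ω w

theorem le_torsoWeight {ω : V → ℝ} (hω : ∀ v, 0 < ω v) (y : F.Node) (u : V) :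
    ω u ≤ Λ.torsoWeight ω y u :=
  le_add_of_nonneg_right (Finset.sum_nonneg fun w _ => (weight_pos hω w).le)

open Classical in
theorem sum_torsoWeight_le {ω : V → ℝ} (hω : ∀ v, 0 < ω v) (y : F.Node) :
    ∑ u with F.home u = y, Λ.torsoWeight ω y u ≤ (k + 1) * Λ.ownWeight ω y := by
  unfold torsoWeight
  rw [Finset.sum_add_distrib]
  have h1 : ∑ u with F.home u = y, ω u ≤ Λ.ownWeight ω y := by
    refine Finset.sum_le_sum_of_subset_of_nonneg ?_ fun v _ _ => (hω v).le
    intro v hv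
    rw [← (Finset.mem_filter.1 hv).2]
    exact home_mem_own v
  have h2 : ∑ u with F.home u = y, ∑ w with Λ.Light w y ∧ u ∈ F.up w, F.weight ω w ≤
      k * Λ.ownWeight ω y := by
    calc ∑ u with F.home u = y, ∑ w with Λ.Light w y ∧ u ∈ F.up w, F.weight ω w
        ≤ ∑ u : V, ∑ w with Λ.Light w y ∧ u ∈ F.up w, F.weight ω w :=
          Finset.sum_le_sum_of_subset_of_nonneg (Finset.filter_subset _ _)
            fun u _ _ => Finset.sum_nonneg fun w _ => (weight_pos hω w).le
      _ = ∑ w with Λ.Light w y, ∑ u ∈ F.up w, F.weight ω w := by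
          apply Finset.sum_comm'
          intro u w
          simp [and_comm]
      _ = ∑ w with Λ.Light w y, ((F.up w).card : ℝ) * F.weight ω w := by simp
      _ ≤ ∑ w with Λ.Light w y, (k : ℝ) * F.weight ω w := by
          refine Finset.sum_le_sum fun w _ => ?_
          have := weight_pos hω w
          have : ((F.up w).card : ℝ) ≤ k := by exact_mod_cast F.card_up w
          gcongr
      _ ≤ k * Λ.ownWeight ω y := by
          rw [← Finset.mul_sum]
          have := sum_light_weight_le (Λ := Λ) hω y
          gcongr
  linarith

open Classical in
theorem exists_code {A : List Bool → List Bool → Bool}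
    {I : List Bool → List Bool → List Bool → Bool} {c₁ c₂ c₃ : ℝ} {G : SimpleGraph V}
    (hloc : ∀ y, ∀ θ : {v // F.home v = y} → ℝ, (∀ v, 0 < θ v) → ∃ μ κ,
      IsWeightedMixedLabelling A I c₁ c₂ c₃ (F.torso y) (G.comap Subtype.val) θ μ κ)
    {ω : V → ℝ} (hω : ∀ v, 0 < ω v) {h : ℝ} (h1 : 1 ≤ h)
    (hh : ∀ t, (((Λ.comp t).filter fun w => ¬ Λ.IsFirst w).card : ℝ) ≤ h) :
    ∃ (S : Λ.Code I) (cl : F.Node → Finset V → List Bool)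
      (ky : F.Node → Finset V → V → List Bool),
      (∀ u v, F.home u = F.home v → S.lab u = S.lab v → u = v) ∧
      (∀ u v, F.home u = F.home v → (A (S.lab u) (S.lab v) = true ↔ G.Adj u v)) ∧
      (∀ y Q Q', F.IsLocalClique y Q → F.IsLocalClique y Q' → cl y Q = cl y Q' →
        ∀ u, F.home u = y → (u ∈ Q ↔ u ∈ Q')) ∧
      (∀ y Q u v, F.IsLocalClique y Q → u ∈ Q → F.home u = y → F.home v = y →
        ((I (cl y Q) (ky y Q u) (S.lab v) = true ↔ u = v) ∧ ((ky y Q u).length : ℝ) ≤ c₂)) ∧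
      (∀ w u, F.parent w = some (F.home u) → u ∈ F.up w → ((S.key w u).length : ℝ) ≤ c₂) ∧
      (∀ y, ((S.pos y).length : ℝ) ≤
        Real.logb 2 (F.weight ω (Λ.top y)) - Real.logb 2 (Λ.ownWeight ω y)) ∧
      (∀ v, (S.tag v).1.length ≤ (S.pos (F.home v)).length.size + 1 ∧
        ((S.tag v).2.length : ℝ) ≤ Real.logb 2 (2 * (k + 1) * h)) ∧
      (∀ v, ((S.lab v).length : ℝ) ≤ Real.logb 2 (k + 1) +
        Real.logb 2 (Λ.ownWeight ω (F.home v)) - Real.logb 2 (ω v) + c₁) ∧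
      (∀ y Q, F.IsLocalClique y Q → ∃ u ∈ Q, ((cl y Q).length : ℝ) ≤ Real.logb 2 (k + 1) +
        Real.logb 2 (Λ.ownWeight ω y) - Real.logb 2 (ω u) + c₃) ∧
      (∀ w, F.parent w = none → S.loc w = [] ∧ ((S.sib w).length : ℝ) ≤
        Real.logb 2 (∑ v, ω v) - Real.logb 2 (F.weight ω w)) ∧
      ∀ w y, Λ.Light w y → ((S.sib w).length : ℝ) + (S.loc w).length ≤ Real.logb 2 (k + 1) +
        Real.logb 2 (Λ.ownWeight ω y) - Real.logb 2 (F.weight ω w) + c₃ := by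
  have hθ0 : ∀ y v, 0 < Λ.torsoWeight ω y v := fun y v => (hω v).trans_le (le_torsoWeight hω y v)
  choose lab cl ky hlab hadj hlablen hcl hky hcllen using fun y =>
    exists_local_labelling y (hloc y) (Λ.torsoWeight ω y) (hθ0 y)
  choose pos tag hpos hposlen htaglen htag using fun t =>
    exists_identifiers (Λ := Λ) hω t h1 (hh t)
  have hk1 : (0 : ℝ) < k + 1 := by positivity
  have hΘ : ∀ y, Real.logb 2 (∑ x with F.home x = y, Λ.torsoWeight ω y x) ≤
      Real.logb 2 (k + 1) + Real.logb 2 (Λ.ownWeight ω y) := by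
    intro y
    rw [← Real.logb_mul hk1.ne' (ownWeight_pos hω y).ne']
    obtain ⟨v, hv⟩ := F.home_surjective y
    exact Real.logb_le_logb_of_le (by norm_num)
      (Finset.sum_pos (fun v _ => hθ0 y v) ⟨v, by simpa using hv⟩) (sum_torsoWeight_le hω y)
  let loc : F.Node → List Bool := fun w => (F.parent w).elim [] fun y => cl y (F.up w)
  let key : F.Node → V → List Bool := fun w u =>
    (F.parent w).elim [] fun y => ky y (F.up w) u
  have hloc_some : ∀ {w y}, F.parent w = some y → loc w = cl y (F.up w) := by
    intro w y h; simp [loc, h]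
  have hkey_some : ∀ {w y u}, F.parent w = some y → key w u = ky y (F.up w) u := by
    intro w y u h; simp [key, h]
  -- siblings with the same local clique label share one weighted code
  let cls : Option F.Node → List Bool → Finset F.Node := fun p l =>
    {w | F.parent w = p ∧ Λ.top w = w ∧ loc w = l}
  choose sib hsib hsiblen using fun (p : Option F.Node) (l : List Bool) =>
    exists_weightedCode (cls p l) (F.weight ω) fun w _ => weight_pos hω w
  have hsiblen' : ∀ w, Λ.top w = w → ((sib (F.parent w) (loc w) w).length : ℝ) ≤
      Real.logb 2 (∑ x ∈ cls (F.parent w) (loc w), F.weight ω x) -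
        Real.logb 2 (F.weight ω w) := fun w hw => hsiblen _ _ _ (by simp [cls, hw])
  have hcls_pos : ∀ w, Λ.top w = w → 0 < ∑ x ∈ cls (F.parent w) (loc w), F.weight ω x :=
    fun w hw => Finset.sum_pos (fun x _ => weight_pos hω x) ⟨w, by simp [cls, hw]⟩
  let S : Λ.Code I :=
    { pos := fun y => pos (Λ.top y) y
      sib := fun w => sib (F.parent w) (loc w) w
      loc := loc
      tag := fun v => tag (Λ.top (F.home v)) v
      lab := fun v => lab (F.home v) v
      key := key
      pos_inj := by
        intro x y hxy hp
        rw [hxy] at hp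
        exact hpos _ x y hxy rfl hp
      sib_inj := by
        intro x y hp hx hy hs hl
        rw [← hp, ← hl] at hs
        exact hsib _ _ (by simp [cls, hx]) (by simp [cls, hp, hl, hy]) hs
      tag_spec := by
        intro y u v huy hu hv
        rw [hu, hv]
        exact htag _ y u v rfl huy hu hv
      key_spec := by
        intro w y u v hw huw hu hv
        rw [hloc_some hw, hkey_some hw, hv]
        exact (hky y _ u v (isLocalClique_up hw) huw hu hv).1 }
  refine ⟨S, cl, ky, ?_, ?_, fun y => hcl y, ?_, ?_, fun y => hposlen _ y rfl,
    fun v => htaglen _ v rfl, ?_, ?_, ?_, ?_⟩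
  · intro u v huv h
    change lab (F.home u) u = lab (F.home v) v at h
    rw [huv] at h
    exact hlab _ u v huv rfl h
  · intro u v huv
    change A (lab (F.home u) u) (lab (F.home v) v) = true ↔ _
    rw [huv]
    exact hadj _ u v huv rfl
  · rintro y Q u v hQ huQ hu rfl
    exact hky _ Q u v hQ huQ hu rfl
  · intro w u hw hu
    change ((key w u).length : ℝ) ≤ c₂
    rw [hkey_some hw]
    exact (hky _ _ u u (isLocalClique_up hw) hu rfl rfl).2
  · intro v
    have h2 := hlablen _ v rfl
    have h3 := hΘ (F.home v)
    have h4 : Real.logb 2 (ω v) ≤ Real.logb 2 (Λ.torsoWeight ω (F.home v) v) :=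
      Real.logb_le_logb_of_le (by norm_num) (hω v) (le_torsoWeight hω _ v)
    change ((lab (F.home v) v).length : ℝ) ≤ _
    linarith
  · intro y Q hQ
    obtain ⟨u, hu, -, h2⟩ := hcllen y Q hQ
    have h3 := hΘ y
    have h4 : Real.logb 2 (ω u) ≤ Real.logb 2 (Λ.torsoWeight ω y u) :=
      Real.logb_le_logb_of_le (by norm_num) (hω u) (le_torsoWeight hω _ u)
    exact ⟨u, hu, by linarith⟩
  · intro w hw
    refine ⟨by simp [S, loc, hw], (hsiblen' w (top_of_root hw)).trans (sub_le_sub_right ?_ _)⟩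
    refine Real.logb_le_logb_of_le (by norm_num) (hcls_pos w (top_of_root hw)) ?_
    unfold weight
    rw [← Finset.sum_biUnion]
    · exact Finset.sum_le_sum_of_subset_of_nonneg (Finset.subset_univ _) fun v _ _ => (hω v).le
    · intro x hx z hz hne
      have hx := (Finset.mem_filter.1 (Finset.mem_coe.1 hx)).2.1
      have hz := (Finset.mem_filter.1 (Finset.mem_coe.1 hz)).2.1
      exact disjoint_desc_of_root (hx.trans hw) (hz.trans hw) hne
  · intro w y hw
    change ((sib (F.parent w) (loc w) w).length : ℝ) + (loc w).length ≤ _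
    have h2 := hsiblen' w hw.top_eq
    obtain ⟨u, hu, huy, h3⟩ := hcllen y _ (isLocalClique_up hw.1)
    rw [← hloc_some hw.1] at h3
    have h4 := hΘ y
    -- all these siblings have `u` in their upward adhesions
    have h5 : ∑ x ∈ cls (F.parent w) (loc w), F.weight ω x ≤ Λ.torsoWeight ω y u := by
      refine le_trans (Finset.sum_le_sum_of_subset_of_nonneg ?_
        fun x _ _ => (weight_pos hω x).le) (le_add_of_nonneg_left (hω u).le)
      intro x hx
      obtain ⟨hxp, hxt, hxl⟩ := (Finset.mem_filter.1 hx).2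
      have hxp' := hxp.trans hw.1
      rw [hloc_some hxp', hloc_some hw.1] at hxl
      refine Finset.mem_filter.2 ⟨Finset.mem_univ _, ⟨hxp', fun hl => ?_⟩,
        (hcl y _ _ (isLocalClique_up hxp') (isLocalClique_up hw.1) hxl u huy).2 hu⟩
      exact not_same_top (Λ := Λ) x y (by rw [hxt]; exact ⟨hxp', hl⟩)
    have h6 := Real.logb_le_logb_of_le (b := 2) (by norm_num) (hcls_pos w hw.top_eq) h5
    linarith

end Levelling

end AdhesionForest

/-! ### Labels and testers -/

/-- The label of a vertex: the address `C` of the component of its home, the position `q` of the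
home, the identifier `a`, pointers `R` to the neighbours in the upward adhesion of the home, and the
local label `l`. -/
def vertexLabel (C : List (List Bool × List Bool × List Bool)) (q : List Bool)
    (a : List Bool × List Bool) (R : List (List Bool × List Bool × List Bool)) (l : List Bool) :
    List Bool :=
  false :: (encodeTriples C ++ (encodeTriples [(q, a.1, a.2)] ++ (encodeTriples R ++ l)))

/-- The label of a clique: the address `C` and the position `q` of the lowest home of its elements,
a string `m` for the elements that live elsewhere, and the local label `l` of the others. -/
def cliqueLabel (C : List (List Bool × List Bool × List Bool)) (q m l : List Bool) : List Bool :=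
  true :: (encodeTriples C ++ (encodeTriples [(q, m, [])] ++ l))

theorem vertexLabel_inj {C C' : List (List Bool × List Bool × List Bool)} {q q' : List Bool}
    {a a' : List Bool × List Bool} {R R' : List (List Bool × List Bool × List Bool)}
    {l l' : List Bool} (h : vertexLabel C q a R l = vertexLabel C' q' a' R' l') :
    C = C' ∧ q = q' ∧ a = a' ∧ R = R' ∧ l = l' := by
  have h := (List.cons.inj h).2
  obtain ⟨h1, h⟩ := encodeTriples_append_inj h
  obtain ⟨h2, h⟩ := encodeTriples_append_inj h
  obtain ⟨h3, h⟩ := encodeTriples_append_inj h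
  simp only [List.cons.injEq, Prod.mk.injEq, and_true] at h2
  exact ⟨h1, h2.1, Prod.ext h2.2.1 h2.2.2, h3, h⟩

theorem cliqueLabel_inj {C C' : List (List Bool × List Bool × List Bool)}
    {q q' m m' l l' : List Bool} (h : cliqueLabel C q m l = cliqueLabel C' q' m' l') :
    C = C' ∧ q = q' ∧ m = m' ∧ l = l' := by
  have h := (List.cons.inj h).2
  obtain ⟨h1, h⟩ := encodeTriples_append_inj h
  obtain ⟨h2, h⟩ := encodeTriples_append_inj h
  simp only [List.cons.injEq, Prod.mk.injEq, and_true] at h2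
  exact ⟨h1, h2.1, h2.2, h⟩

open Classical in
/-- The adjacency tester: two vertices with the same home are compared by the given tester `A`, and
otherwise one of them has to point to the other. -/
noncomputable def glueAdj (A : List Bool → List Bool → Bool)
    (I : List Bool → List Bool → List Bool → Bool) (x x' : List Bool) : Bool :=
  decide (∃ C q a R l C' q' a' R' l', x = vertexLabel C q a R l ∧ x' = vertexLabel C' q' a' R' l' ∧
    ((C = C' ∧ q = q' ∧ A l l' = true) ∨ (∃ p ∈ R, Hits I (C ++ [([], q, [])]) p C' q' a' l') ∨
      ∃ p ∈ R', Hits I (C' ++ [([], q', [])]) p C q a l))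

open Classical in
/-- The tester for elements of cliques: the local string is a pointer. -/
noncomputable def glueMem (I : List Bool → List Bool → List Bool → Bool) (z s x : List Bool) :
    Bool :=
  decide (∃ C q m l p C' q' a' R' l', z = cliqueLabel C q m l ∧ s = encodeTriples [p] ∧
    x = vertexLabel C' q' a' R' l' ∧ Hits I (C ++ [([], q, l)]) p C' q' a' l')

open Classical in
theorem glueAdj_vertexLabel (A : List Bool → List Bool → Bool)
    (I : List Bool → List Bool → List Bool → Bool)
    (C C' : List (List Bool × List Bool × List Bool)) (q q' : List Bool)
    (a a' : List Bool × List Bool) (R R' : List (List Bool × List Bool × List Bool))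
    (l l' : List Bool) :
    glueAdj A I (vertexLabel C q a R l) (vertexLabel C' q' a' R' l') = true ↔
    ((C = C' ∧ q = q' ∧ A l l' = true) ∨ (∃ p ∈ R, Hits I (C ++ [([], q, [])]) p C' q' a' l') ∨
      ∃ p ∈ R', Hits I (C' ++ [([], q', [])]) p C q a l) := by
  rw [glueAdj, decide_eq_true_iff]
  constructor
  · rintro ⟨C₁, q₁, a₁, R₁, l₁, C₂, q₂, a₂, R₂, l₂, h1, h2, h⟩
    obtain ⟨rfl, rfl, rfl, rfl, rfl⟩ := vertexLabel_inj h1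
    obtain ⟨rfl, rfl, rfl, rfl, rfl⟩ := vertexLabel_inj h2
    exact h
  · intro h
    exact ⟨C, q, a, R, l, C', q', a', R', l', rfl, rfl, h⟩

open Classical in
theorem glueMem_cliqueLabel (I : List Bool → List Bool → List Bool → Bool)
    (C C' : List (List Bool × List Bool × List Bool)) (q q' m l l' : List Bool)
    (p : List Bool × List Bool × List Bool) (a' : List Bool × List Bool)
    (R' : List (List Bool × List Bool × List Bool)) :
    glueMem I (cliqueLabel C q m l) (encodeTriples [p]) (vertexLabel C' q' a' R' l') = true ↔
      Hits I (C ++ [([], q, l)]) p C' q' a' l' := by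
  rw [glueMem, decide_eq_true_iff]
  constructor
  · rintro ⟨C₁, q₁, m₁, l₁, p₁, C₂, q₂, a₂, R₂, l₂, h1, h2, h3, h⟩
    obtain ⟨rfl, rfl, rfl, rfl⟩ := cliqueLabel_inj h1
    obtain ⟨h2, -⟩ := encodeTriples_append_inj (r := []) (s := []) (congrArg (· ++ []) h2)
    obtain ⟨rfl, rfl, rfl, rfl, rfl⟩ := vertexLabel_inj h3
    rw [(List.cons.inj h2).1]
    exact h
  · intro h
    exact ⟨C, q, m, l, p, C', q', a', R', l', rfl, rfl, rfl, h⟩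

theorem tripleCost_append (c : ℝ) (l m : List (List Bool × List Bool × List Bool)) :
    tripleCost c (l ++ m) = tripleCost c l + tripleCost c m := by
  simp [tripleCost]

theorem tripleCost_singleton (c : ℝ) (e : List Bool × List Bool × List Bool) :
    tripleCost c [e] = (e.1.length : ℝ) + e.2.1.length + e.2.2.length + c := by
  simp [tripleCost]

theorem size_le_self (n : ℕ) : n.size ≤ n := Nat.size_le.2 Nat.lt_two_pow_self

namespace AdhesionForest

variable {V : Type} [Fintype V] {Gp : SimpleGraph V} {𝒢 : GraphClass} {k : ℕ}
  {F : AdhesionForest Gp 𝒢 k}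

/-- The elements of a clique live at one node and in its upward adhesion. -/
theorem exists_lowest (Q : CliqueOf Gp) :
    ∃ y, F.IsLocalClique y Q.1 ∧ ∀ u ∈ Q.1, F.home u = y ∨ u ∈ F.up y := by
  obtain ⟨v, hv, hmax⟩ := Finset.exists_max_image Q.1 (fun v => F.depth (F.home v)) Q.2.1
  refine ⟨F.home v, ⟨⟨v, hv, rfl⟩, ?_⟩, ?_⟩
  · intro u w hu hw huw
    exact F.torso_of_adj _ u w (Q.2.2 hu hw fun h => huw (Subtype.ext h))
  · intro u hu
    by_cases huv : u = v
    · exact Or.inl (by rw [huv])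
    · rcases F.adj_home u v (Q.2.2 hu hv huv) with h | h | h
      · exact Or.inl h
      · exact Or.inr h
      · have := (below_home_of_mem_up h).2
        have := hmax u hu
        omega

namespace Levelling.Code

variable {Λ : F.Levelling} {I : List Bool → List Bool → List Bool → Bool} {S : Λ.Code I}

theorem forall_mem_chain {P : List Bool × List Bool × List Bool → Prop}
    (hroot : ∀ w, F.parent w = none → P (S.sib w, [], S.loc w))
    (hlight : ∀ w y, Λ.Light w y → P (S.sib w, S.pos y, S.loc w)) (w : F.Node) :
    ∀ e ∈ S.chain w, P e := by
  induction hn : F.depth w using Nat.strong_induction_on generalizing w with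
  | _ n ih =>
    rcases cases_parent (Λ := Λ) w with h | ⟨y, h⟩ | ⟨y, h⟩
    · simpa [chain_root h] using hroot w h
    · have := F.depth_parent _ _ h.1
      rw [chain_same h]
      exact ih (F.depth y) (by omega) y rfl
    · have := F.depth_parent _ _ h.1
      intro e he
      rw [chain_light h, List.mem_append, List.mem_singleton] at he
      rcases he with he | rfl
      · exact ih (F.depth y) (by omega) y rfl e he
      · exact hlight w y h

/-- The lengths of the entries of an address telescope. -/
theorem tripleCost_chain_le {ω : V → ℝ} {c r : ℝ} (hc : 0 ≤ c) (hr : 0 ≤ r)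
    (hpos : ∀ y, ((S.pos y).length : ℝ) ≤
      Real.logb 2 (F.weight ω (Λ.top y)) - Real.logb 2 (Λ.ownWeight ω y))
    (hroot : ∀ w, F.parent w = none → S.loc w = [] ∧ ((S.sib w).length : ℝ) ≤
      Real.logb 2 (∑ v, ω v) - Real.logb 2 (F.weight ω w))
    (hlight : ∀ w y, Λ.Light w y → ((S.sib w).length : ℝ) + (S.loc w).length ≤
      Real.logb 2 (Λ.ownWeight ω y) - Real.logb 2 (F.weight ω w) + r) (w : F.Node) :
    tripleCost c (S.chain w) ≤ Real.logb 2 (∑ v, ω v) - Real.logb 2 (F.weight ω (Λ.top w)) +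
      (Λ.lev w + 1) * (r + c) := by
  induction hn : F.depth w using Nat.strong_induction_on generalizing w with
  | _ n ih =>
    rcases cases_parent (Λ := Λ) w with h | ⟨y, h⟩ | ⟨y, h⟩
    · obtain ⟨h1, h2⟩ := hroot w h
      rw [chain_root h, tripleCost_singleton, h1, top_of_root h]
      have : 0 ≤ (Λ.lev w : ℝ) * (r + c) := by positivity
      simp only [List.length_nil, Nat.cast_zero]
      linarith
    · have := F.depth_parent _ _ h.1
      rw [chain_same h, h.top_eq, h.2]
      exact ih (F.depth y) (by omega) y rfl
    · have := F.depth_parent _ _ h.1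
      have h1 := ih (F.depth y) (by omega) y rfl
      have h2 := Λ.mono _ _ h.1
      have h3 := h.2
      have h4 : (Λ.lev y : ℝ) + 1 ≤ Λ.lev w := by exact_mod_cast (by omega : Λ.lev y + 1 ≤ Λ.lev w)
      have h5 := hpos y
      have h6 := hlight w y h
      have h7 : ((Λ.lev y : ℝ) + 1) * (r + c) ≤ Λ.lev w * (r + c) :=
        mul_le_mul_of_nonneg_right h4 (by linarith)
      rw [chain_light h, tripleCost_append, tripleCost_singleton, h.top_eq]
      dsimp only
      linarith

end Levelling.Code

open Classical in
/-- The labellings of the torsos are glued to a labelling of the whole graph. Here `h` bounds the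
number of chains of distinguished children in a component, `ℓ` is the largest level, and `N` bounds
the lengths of all strings that are delimited. -/
theorem exists_glued_labelling [Nonempty V] {A : List Bool → List Bool → Bool}
    {I : List Bool → List Bool → List Bool → Bool} {c₁ c₂ c₃ : ℝ} (hc₂ : 0 ≤ c₂) (hc₃ : 0 ≤ c₃)
    {G : SimpleGraph V} (hG : G ≤ Gp) (Λ : F.Levelling)
    (hloc : ∀ y, ∀ θ : {v // F.home v = y} → ℝ, (∀ v, 0 < θ v) → ∃ μ κ,
      IsWeightedMixedLabelling A I c₁ c₂ c₃ (F.torso y) (G.comap Subtype.val) θ μ κ)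
    {ω : V → ℝ} (hω : ∀ v, 1 ≤ ω v) {h : ℝ} (h1 : 1 ≤ h)
    (hh : ∀ t, (((Λ.comp t).filter fun w => ¬ Λ.IsFirst w).card : ℝ) ≤ h)
    {ℓ N : ℕ} (hℓ : ∀ y, Λ.lev y ≤ ℓ)
    (hN : Real.logb 2 (∑ v, ω v) + Real.logb 2 (k + 1) + c₃ + Real.logb 2 (2 * (k + 1) * h) + c₂ +
      k + ℓ + 2 ≤ N) :
    ∃ μ κ, IsWeightedMixedLabelling (glueAdj A I) (glueMem I)
      (c₁ + (ℓ + 1) * (Real.logb 2 (k + 1) + c₃ + (6 * N.size + 4)) + Real.logb 2 (k + 1) + 5 +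
        2 * (6 * N.size + 4) + Real.logb 2 (2 * (k + 1) * h) +
        k * (2 * (6 * N.size + 4) + Real.logb 2 (2 * (k + 1) * h) + c₂))
      (2 * (6 * N.size + 4) + Real.logb 2 (2 * (k + 1) * h) + c₂ + 1)
      (c₃ + (ℓ + 1) * (Real.logb 2 (k + 1) + c₃ + (6 * N.size + 4)) + Real.logb 2 (k + 1) + 4 +
        (6 * N.size + 4) + k)
      Gp G ω μ κ := by
  have hω0 : ∀ v, 0 < ω v := fun v => one_pos.trans_le (hω v)
  obtain ⟨S, cl, ky, hlab, hadj, hcl, hky, hkey, hpos, htag, hlablen, hcllen, hroot, hlight⟩ :=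
    Levelling.exists_code hloc hω0 h1 hh
  have hk0 : (0 : ℝ) ≤ k := Nat.cast_nonneg k
  set c : ℝ := 6 * N.size + 4 with hc
  set Lk := Real.logb 2 ((k : ℝ) + 1) with hLk
  set τ := Real.logb 2 (2 * ((k : ℝ) + 1) * h) with hτ
  have hLk0 : 0 ≤ Lk := Real.logb_nonneg (by norm_num) (by linarith)
  have hτ0 : 0 ≤ τ := Real.logb_nonneg (by norm_num) (by nlinarith)
  have hc0 : 0 ≤ c := by positivity
  have hℓ0 : (0 : ℝ) ≤ ℓ := Nat.cast_nonneg ℓ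
  -- bounds for the lengths of the strings
  have hlogω : ∀ v, 0 ≤ Real.logb 2 (ω v) := fun v => Real.logb_nonneg (by norm_num) (hω v)
  have hown : ∀ y, 0 ≤ Real.logb 2 (Λ.ownWeight ω y) := by
    intro y
    obtain ⟨v, hv⟩ := Levelling.own_nonempty (Λ := Λ) y
    exact Real.logb_nonneg (by norm_num)
      ((hω v).trans (Finset.single_le_sum (fun v _ => (hω0 v).le) hv))
  have hweight : ∀ y, Real.logb 2 (F.weight ω y) ≤ Real.logb 2 (∑ v, ω v) := fun y =>
    Real.logb_le_logb_of_le (by norm_num) (weight_pos hω0 y)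
      (Finset.sum_le_sum_of_subset_of_nonneg (Finset.subset_univ _) fun v _ _ => (hω0 v).le)
  have hweight0 : ∀ y, 0 ≤ Real.logb 2 (F.weight ω y) := by
    intro y
    obtain ⟨v, hv⟩ := F.home_surjective y
    exact Real.logb_nonneg (by norm_num) ((hω v).trans (Finset.single_le_sum
      (fun v _ => (hω0 v).le) (mem_desc.2 (hv ▸ Below.refl _))))
  have hownle : ∀ y, Real.logb 2 (Λ.ownWeight ω y) ≤ Real.logb 2 (∑ v, ω v) := fun y =>
    Real.logb_le_logb_of_le (by norm_num) (Levelling.ownWeight_pos hω0 y)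
      (Finset.sum_le_sum_of_subset_of_nonneg (Finset.subset_univ _) fun v _ _ => (hω0 v).le)
  have hM : 0 ≤ Real.logb 2 (∑ v, ω v) := by
    obtain ⟨v⟩ := ‹Nonempty V›
    exact (hlogω v).trans (Real.logb_le_logb_of_le (by norm_num) (hω0 v)
      (Finset.single_le_sum (fun v _ => (hω0 v).le) (Finset.mem_univ v)))
  have hnat : ∀ x : ℕ, (x : ℝ) ≤ N → x ≤ N := fun x hx => by exact_mod_cast hx
  have hposN : ∀ y, ((S.pos y).length : ℝ) + 2 ≤ N := by
    intro y
    have := hpos y; have := hown y; have := hweight (Λ.top y)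
    linarith
  have hposN' : ∀ y, (S.pos y).length ≤ N := fun y => hnat _ (by have := hposN y; linarith)
  have htag1 : ∀ v, (S.tag v).1.length + 1 ≤ N := by
    intro v
    have h2 := (htag v).1
    have h3 := size_le_self (S.pos (F.home v)).length
    have h4 : (S.pos (F.home v)).length + 2 ≤ N := by
      have := hposN (F.home v)
      exact_mod_cast this
    omega
  have htag1' : ∀ v, ((S.tag v).1.length : ℝ) ≤ N.size + 1 := by
    intro v
    have h2 := (htag v).1
    have h3 := Nat.size_le_size (hposN' (F.home v))
    exact_mod_cast h2.trans (Nat.succ_le_succ h3)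
  have htag2 : ∀ v, (S.tag v).2.length ≤ N := fun v =>
    hnat _ ((htag v).2.trans (by linarith))
  have hchainlen : ∀ y, (S.chain y).length ≤ ℓ + 1 := fun y =>
    Levelling.Code.length_chain_le y |>.trans (Nat.succ_le_succ (hℓ y))
  have hℓN : ℓ + 1 ≤ N := hnat _ (by push_cast; linarith)
  have hchainN : ∀ y, ∀ e ∈ S.chain y,
      e.1.length ≤ N ∧ e.2.1.length ≤ N ∧ e.2.2.length ≤ N := by
    intro y
    refine Levelling.Code.forall_mem_chain ?_ ?_ y
    · intro w hw
      obtain ⟨h2, h3⟩ := hroot w hw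
      refine ⟨hnat _ (h3.trans ?_), by simp, by simp [h2]⟩
      have := hweight0 w
      linarith
    · intro w y hw
      have h2 := hlight w y hw
      have h3 := hownle y
      have h4 := hweight0 w
      have h5 : (0 : ℝ) ≤ (S.sib w).length := Nat.cast_nonneg _
      have h6 : (0 : ℝ) ≤ (S.loc w).length := Nat.cast_nonneg _
      exact ⟨hnat _ (by linarith), hposN' y, hnat _ (by linarith)⟩
  have hchain : ∀ y, ((encodeTriples (S.chain y)).length : ℝ) ≤ Real.logb 2 (∑ v, ω v) -
      Real.logb 2 (F.weight ω (Λ.top y)) + (ℓ + 1) * (Lk + c₃ + c) + 1 := by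
    intro y
    have h2 := length_encodeTriples_le (S.chain y) (hchainN y)
    have h3 := Levelling.Code.tripleCost_chain_le (S := S) hc0 (add_nonneg hLk0 hc₃) hpos hroot
      (fun w y hw => by have := hlight w y hw; linarith) y
    have h4 : ((Λ.lev y : ℝ) + 1) * (Lk + c₃ + c) ≤ (ℓ + 1) * (Lk + c₃ + c) := by
      have : (Λ.lev y : ℝ) ≤ ℓ := by exact_mod_cast hℓ y
      gcongr
    linarith
  have hpair : ∀ q m r : List Bool, q.length ≤ N → m.length ≤ N → r.length ≤ N →
      ((encodeTriples [(q, m, r)]).length : ℝ) ≤ q.length + m.length + r.length + c + 1 := by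
    intro q m r hq hm hr
    have := length_encodeTriples_le (N := N) [(q, m, r)] (by simp [hq, hm, hr])
    rwa [tripleCost_singleton] at this
  have hc₂N : c₂ ≤ N := by linarith
  -- pointers to the vertices of the upward adhesions
  have hptr : ∀ y u, ∃ p : List Bool × List Bool × List Bool, u ∈ F.up y →
      (p.1.length ≤ N ∧ p.2.1.length ≤ N ∧ p.2.2.length ≤ N) ∧
      (p.1.length : ℝ) + p.2.1.length + p.2.2.length + c ≤ 2 * c + τ + c₂ ∧
      ∀ s m R v, S.PointsTo (S.chain y ++ (s, S.pos y, m) :: R) p v ↔ u = v := by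
    intro y u
    by_cases hu : u ∈ F.up y
    · obtain ⟨p, ⟨i, hi, hpi⟩, hp, hp'⟩ := Levelling.Code.exists_pointer (S := S) hu
      refine ⟨p, fun _ => ⟨?_, ?_, hp'⟩⟩
      · have h2 : p.1.length ≤ N := by
          rw [hpi, Nat.size_eq_bits_len]
          have := size_le_self i
          have := hchainlen y
          omega
        rcases hp with hp | ⟨w, hw, huw, hp⟩
        · rw [hp]
          exact ⟨h2, htag1 u, htag2 u⟩
        · rw [hp]
          exact ⟨h2, by simp, hnat _ ((hkey w u hw huw).trans hc₂N)⟩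
      · have h2 : (p.1.length : ℝ) ≤ N.size := by
          rw [hpi, Nat.size_eq_bits_len]
          have := hchainlen y
          exact_mod_cast Nat.size_le_size (by omega : i ≤ N)
        have h3 : (0 : ℝ) ≤ N.size := Nat.cast_nonneg _
        rcases hp with hp | ⟨w, hw, huw, hp⟩
        · have h4 := htag1' u
          have h5 := (htag u).2
          rw [hp]
          push_cast [List.length_cons]
          linarith
        · have h4 := hkey w u hw huw
          rw [hp]
          simp only [List.length_nil, Nat.cast_zero]
          linarith
    · exact ⟨([], [], []), fun h => absurd h hu⟩
  choose ptr hptr using hptr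
  choose low hlow hlow' using exists_lowest (F := F)
  choose mask hmask hmasklen using fun y => _root_.exists_code (F.up y).powerset
  let nbr : V → List V := fun v => ((F.up (F.home v)).filter fun u => G.Adj v u).toList
  have hnbr : ∀ u v, v ∈ nbr u ↔ v ∈ F.up (F.home u) ∧ G.Adj u v := by
    intro u v
    simp [nbr]
  let R : V → List (List Bool × List Bool × List Bool) := fun v => (nbr v).map (ptr (F.home v))
  let rest : CliqueOf Gp → Finset V := fun Q => Q.1.filter fun u => F.home u ≠ low Q
  have hrest : ∀ Q, rest Q ∈ (F.up (low Q)).powerset := by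
    intro Q
    rw [Finset.mem_powerset]
    intro u hu
    obtain ⟨hu, hu'⟩ := Finset.mem_filter.1 hu
    exact (hlow' Q u hu).resolve_left hu'
  have hmaskk : ∀ Q, ((mask (low Q) (rest Q)).length : ℝ) ≤ k := by
    intro Q
    have h2 := hmasklen _ _ (hrest Q)
    rw [Finset.card_powerset] at h2
    push_cast at h2
    rw [Real.logb_pow, Real.logb_self_eq_one (by norm_num), mul_one] at h2
    exact h2.trans (by exact_mod_cast F.card_up _)
  let μ : V ⊕ CliqueOf Gp → List Bool := Sum.elim
    (fun v => vertexLabel (S.chain (F.home v)) (S.pos (F.home v)) (S.tag v) (R v) (S.lab v))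
    (fun Q => cliqueLabel (S.chain (low Q)) (S.pos (low Q)) (mask (low Q) (rest Q))
      (cl (low Q) Q.1))
  let p : CliqueOf Gp → V → List Bool × List Bool × List Bool := fun Q u =>
    if F.home u = low Q then ((S.chain (low Q)).length.bits, [], ky (low Q) Q.1 u)
    else ptr (low Q) u
  refine ⟨μ, fun Q u => encodeTriples [p Q u], ?_⟩
  have hhits : ∀ u v, (∃ e ∈ R u, Hits I (S.chain (F.home u) ++ [([], S.pos (F.home u), [])]) e
      (S.chain (F.home v)) (S.pos (F.home v)) (S.tag v) (S.lab v)) ↔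
      v ∈ F.up (F.home u) ∧ G.Adj u v := by
    intro u v
    constructor
    · rintro ⟨e, he, hit⟩
      obtain ⟨w, hw, rfl⟩ := List.mem_map.1 he
      have hw := (hnbr u w).1 hw
      have := ((hptr _ w hw.1).2.2 [] [] [] v).1 hit
      rw [← this]
      exact hw
    · intro hv
      exact ⟨ptr (F.home u) v, List.mem_map.2 ⟨v, (hnbr u v).2 hv, rfl⟩,
        ((hptr _ v hv.1).2.2 [] [] [] v).2 rfl⟩
  refine ⟨?_, ?_, ?_, ?_, ?_, ?_⟩
  · rintro (u | Q) (v | Q') he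
    · obtain ⟨h2, h3, -, -, h4⟩ := vertexLabel_inj he
      exact congrArg Sum.inl (hlab u v (Levelling.Code.eq_of_chain_pos h2 h3) h4)
    · exact absurd (List.cons.inj he).1 (by simp)
    · exact absurd (List.cons.inj he).1 (by simp)
    · obtain ⟨h2, h3, h4, h5⟩ := cliqueLabel_inj he
      have hl := Levelling.Code.eq_of_chain_pos h2 h3
      have hQ' := hlow Q'
      have hr' := hrest Q'
      rw [← hl] at h4 h5 hQ' hr'
      have hrr := hmask _ (Finset.mem_coe.2 (hrest Q)) (Finset.mem_coe.2 hr') h4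
      refine congrArg Sum.inr (Subtype.ext (Finset.ext fun u => ?_))
      by_cases hu : F.home u = low Q
      · exact hcl _ _ _ (hlow Q) hQ' h5 u hu
      · have h6 : u ∈ rest Q ↔ u ∈ Q.1 := by simp [rest, hu]
        have h7 : u ∈ rest Q' ↔ u ∈ Q'.1 := by simp [rest, ← hl, hu]
        rw [← h6, ← h7, hrr]
  · intro u v
    change glueAdj A I (vertexLabel _ _ _ _ _) (vertexLabel _ _ _ _ _) = true ↔ _
    rw [glueAdj_vertexLabel, hhits u v, hhits v u]
    constructor
    · rintro (⟨h2, h3, h4⟩ | h2 | h2)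
      · exact (hadj u v (Levelling.Code.eq_of_chain_pos h2 h3)).1 h4
      · exact h2.2
      · exact h2.2.symm
    · intro huv
      rcases F.adj_home u v (hG huv) with h2 | h2 | h2
      · exact Or.inl ⟨by rw [h2], by rw [h2], (hadj u v h2).2 huv⟩
      · exact Or.inr (Or.inr ⟨h2, huv.symm⟩)
      · exact Or.inr (Or.inl ⟨h2, huv⟩)
  · intro Q u v hu
    change glueMem I (cliqueLabel _ _ _ _) (encodeTriples [p Q u]) (vertexLabel _ _ _ _ _) = true ↔ _
    rw [glueMem_cliqueLabel]
    by_cases huy : F.home u = low Q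
    · simp only [p, if_pos huy]
      rw [hits_append]
      constructor
      · rintro ⟨h2, ⟨z, hz, -⟩ | ⟨-, h3, h4⟩⟩
        · simp at hz
        · exact (hky _ _ u v (hlow Q) hu huy (Levelling.Code.eq_of_chain_pos h2 h3).symm).1.1 h4
      · rintro rfl
        exact ⟨by rw [huy], Or.inr ⟨rfl, by rw [huy], (hky _ _ u u (hlow Q) hu huy huy).1.2 rfl⟩⟩
    · simp only [p, if_neg huy]
      exact (hptr _ u ((hlow' Q u hu).resolve_left huy)).2.2 _ _ _ v
  · intro v
    have h2 := hchain (F.home v)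
    have h3 := hpair _ _ _ (hposN' (F.home v)) ((Nat.le_succ _).trans (htag1 v)) (htag2 v)
    have h4 := hpos (F.home v)
    have h5 := htag1' v
    have h6 := (htag v).2
    have h7 := hlablen v
    have h8 : ((encodeTriples (R v)).length : ℝ) ≤ k * (2 * c + τ + c₂) + 1 := by
      have hmem : ∀ u ∈ nbr v, u ∈ F.up (F.home v) := fun u hu => ((hnbr v u).1 hu).1
      have h9 := length_encodeTriples_le (N := N) (R v) (by
        intro e he
        obtain ⟨u, hu, rfl⟩ := List.mem_map.1 he
        exact (hptr _ u (hmem u hu)).1)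
      refine h9.trans (add_le_add_left ?_ 1)
      have h10 : tripleCost c (R v) ≤ (nbr v).length • (2 * c + τ + c₂) := by
        unfold tripleCost
        refine (List.sum_le_card_nsmul _ (2 * c + τ + c₂) ?_).trans (by simp [R])
        intro x hx
        obtain ⟨e, he, rfl⟩ := List.mem_map.1 hx
        obtain ⟨u, hu, rfl⟩ := List.mem_map.1 he
        exact (hptr _ u (hmem u hu)).2.1
      have h11 : (nbr v).length ≤ k := by
        rw [Finset.length_toList]
        exact (Finset.card_filter_le _ _).trans (F.card_up _)
      rw [nsmul_eq_mul] at h10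
      refine h10.trans (mul_le_mul_of_nonneg_right (by exact_mod_cast h11) (by linarith))
    have h12 : (0 : ℝ) ≤ N.size := Nat.cast_nonneg _
    change ((vertexLabel _ _ _ _ _).length : ℝ) ≤ _
    simp only [vertexLabel, List.length_cons, List.length_append, Nat.cast_add, Nat.cast_one]
    linarith
  · intro Q
    obtain ⟨u, hu, h2⟩ := hcllen _ _ (hlow Q)
    have h3 := hchain (low Q)
    have hmN : (mask (low Q) (rest Q)).length ≤ N := hnat _ ((hmaskk Q).trans (by linarith))
    have h4 := hpair _ _ [] (hposN' (low Q)) hmN (by simp)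
    have h5 := hpos (low Q)
    have h6 := hmaskk Q
    have h7 : Real.logb 2 (Q.1.inf' Q.2.1 ω) ≤ Real.logb 2 (ω u) :=
      Real.logb_le_logb_of_le (by norm_num)
        ((Finset.lt_inf'_iff Q.2.1).2 fun v _ => hω0 v) (Finset.inf'_le ω hu)
    change ((cliqueLabel _ _ _ _).length : ℝ) ≤ _
    simp only [cliqueLabel, List.length_cons, List.length_append, Nat.cast_add, Nat.cast_one,
      List.length_nil, Nat.cast_zero] at h4 ⊢
    linarith
  · intro Q u hu
    by_cases huy : F.home u = low Q
    · have h2 := (hky _ _ u u (hlow Q) hu huy huy).2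
      have h3 := hchainlen (low Q)
      have h4 := hpair (S.chain (low Q)).length.bits [] (ky (low Q) Q.1 u)
        (by rw [Nat.size_eq_bits_len]; have := size_le_self (S.chain (low Q)).length; omega)
        (by simp) (hnat _ (h2.trans hc₂N))
      have h5 : ((S.chain (low Q)).length.size : ℝ) ≤ N.size := by
        exact_mod_cast Nat.size_le_size (h3.trans hℓN)
      have h6 : (0 : ℝ) ≤ N.size := Nat.cast_nonneg _
      rw [Nat.size_eq_bits_len] at h4
      simp only [p, if_pos huy, List.length_nil, Nat.cast_zero] at h4 ⊢
      linarith
    · obtain ⟨⟨h2, h3, h4⟩, h5, -⟩ := hptr _ u ((hlow' Q u hu).resolve_left huy)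
      have h6 := hpair _ _ _ h2 h3 h4
      simp only [p, if_neg huy]
      linarith

end AdhesionForest

/-! ### The scheme for the tree closure -/

namespace AdhesionForest

variable {V : Type} [Fintype V] {Gp : SimpleGraph V} {𝒢 : GraphClass} {k : ℕ}
  (F : AdhesionForest Gp 𝒢 k)

open Classical in
/-- Levels of width `σ` in the logarithm of the weight: weights on one level differ by a factor of
at most `2 ^ σ`, so a component has at most `2 ^ σ` chains. -/
theorem exists_levelling {ω : V → ℝ} (hω : ∀ v, 1 ≤ ω v) {σ : ℝ} (hσ : 0 < σ) :
    ∃ Λ : F.Levelling, (∀ y, Λ.lev y ≤ ⌊Real.logb 2 (∑ v, ω v) / σ⌋₊) ∧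
      ∀ t, (((Λ.comp t).filter fun w => ¬ Λ.IsFirst w).card : ℝ) ≤ 2 ^ σ := by
  have hω0 : ∀ v, 0 < ω v := fun v => one_pos.trans_le (hω v)
  set M := Real.logb 2 (∑ v, ω v) with hM
  have hw1 : ∀ y, 0 ≤ Real.logb 2 (F.weight ω y) := by
    intro y
    obtain ⟨v, hv⟩ := F.home_surjective y
    exact Real.logb_nonneg (by norm_num) ((hω v).trans (Finset.single_le_sum
      (fun v _ => (hω0 v).le) (mem_desc.2 (hv ▸ Below.refl _))))
  have hwM : ∀ y, Real.logb 2 (F.weight ω y) ≤ M := fun y =>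
    Real.logb_le_logb_of_le (by norm_num) (weight_pos hω0 y)
      (Finset.sum_le_sum_of_subset_of_nonneg (Finset.subset_univ _) fun v _ _ => (hω0 v).le)
  let Λ : F.Levelling :=
    { lev := fun y => ⌊(M - Real.logb 2 (F.weight ω y)) / σ⌋₊
      mono := by
        intro w y h
        have := Real.logb_le_logb_of_le (b := 2) (by norm_num) (weight_pos hω0 w)
          (weight_mono hω0 (Below.parent h))
        apply Nat.floor_le_floor
        gcongr }
  refine ⟨Λ, ?_, ?_⟩
  · intro y
    have := hw1 y
    apply Nat.floor_le_floor
    gcongr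
    linarith
  · intro t
    set j := ⌊(M - Real.logb 2 (F.weight ω t)) / σ⌋₊ with hj
    have hβ : ∀ y ∈ Λ.comp t, (2 : ℝ) ^ (M - (j + 1) * σ) ≤ F.weight ω y := by
      intro y hy
      have h1 : Λ.lev y = j := by
        have h2 := Levelling.mem_comp.1 hy
        have := (Levelling.top_spec (Λ := Λ) y).2
        rw [h2] at this
        exact this.symm
      have h2 : (M - Real.logb 2 (F.weight ω y)) / σ < j + 1 := by
        rw [← h1]
        exact Nat.lt_floor_add_one _
      rw [div_lt_iff₀ hσ] at h2
      rw [← Real.le_logb_iff_rpow_le (by norm_num) (weight_pos hω0 y)]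
      linarith
    have h1 := Levelling.card_heads_mul_le hω0 hβ
    have h2 : F.weight ω t ≤ 2 ^ (M - j * σ) := by
      have h3 : (j : ℝ) ≤ (M - Real.logb 2 (F.weight ω t)) / σ :=
        Nat.floor_le (div_nonneg (by linarith [hwM t]) hσ.le)
      rw [le_div_iff₀ hσ] at h3
      rw [← Real.logb_le_iff_le_rpow (by norm_num) (weight_pos hω0 t)]
      linarith
    have h3 : (2 : ℝ) ^ (M - j * σ) = 2 ^ σ * 2 ^ (M - (j + 1) * σ) := by
      rw [← Real.rpow_add (by norm_num)]
      ring_nf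
    have h4 := h1.trans h2
    rw [h3] at h4
    exact le_of_mul_le_mul_right h4 (by positivity)

end AdhesionForest

theorem IsWeightedMixedLabelling.mono {V : Type} [Fintype V] {A : List Bool → List Bool → Bool}
    {I : List Bool → List Bool → List Bool → Bool} {b₁ b₂ b₃ b₁' b₂' b₃' : ℝ}
    {Gp G : SimpleGraph V} {ω : V → ℝ} {μ : V ⊕ CliqueOf Gp → List Bool}
    {κ : CliqueOf Gp → V → List Bool} (h : IsWeightedMixedLabelling A I b₁ b₂ b₃ Gp G ω μ κ)
    (h₁ : b₁ ≤ b₁') (h₂ : b₂ ≤ b₂') (h₃ : b₃ ≤ b₃') :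
    IsWeightedMixedLabelling A I b₁' b₂' b₃' Gp G ω μ κ where
  injective := h.injective
  adjacency := h.adjacency
  identity := h.identity
  length_vertex v := (h.length_vertex v).trans (by gcongr)
  length_clique K := (h.length_clique K).trans (by gcongr)
  length_local K u hu := (h.length_local K u hu).trans h₂

theorem GraphClass.AdmitsMixedScheme.mono {𝒢 : GraphClass} {g₁ g₂ g₃ g₁' g₂' g₃' : ℕ → ℝ}
    (h : 𝒢.AdmitsMixedScheme g₁ g₂ g₃) (h₁ : g₁ ≤ g₁') (h₂ : g₂ ≤ g₂') (h₃ : g₃ ≤ g₃') :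
    𝒢.AdmitsMixedScheme g₁' g₂' g₃' := by
  obtain ⟨A, I, h⟩ := h
  refine ⟨A, I, fun V _ _ Gp G ω hGp hG hω => ?_⟩
  obtain ⟨μ, κ, h⟩ := h V Gp G ω hGp hG hω
  exact ⟨μ, κ, h.mono (h₁ _) (h₂ _) (h₃ _)⟩

/-- Every weight function can be replaced by one whose values are at least `1` and add up to `2 n`,
at the expense of one bit. -/
theorem exists_labelling_of_normalized {V : Type} [Fintype V] [Nonempty V]
    {A : List Bool → List Bool → Bool} {I : List Bool → List Bool → List Bool → Bool}
    {b₁ b₂ b₃ : ℝ} {Gp G : SimpleGraph V}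
    (h : ∀ ω : V → ℝ, (∀ v, 1 ≤ ω v) → ∑ v, ω v = 2 * Fintype.card V →
      ∃ μ κ, IsWeightedMixedLabelling A I b₁ b₂ b₃ Gp G ω μ κ)
    {ω : V → ℝ} (hω : ∀ v, 0 < ω v) :
    ∃ μ κ, IsWeightedMixedLabelling A I (b₁ + 1) b₂ (b₃ + 1) Gp G ω μ κ := by
  set Ω := ∑ v, ω v with hΩ
  have hΩ0 : 0 < Ω := Finset.sum_pos (fun v _ => hω v) Finset.univ_nonempty
  have hn : (0 : ℝ) < Fintype.card V := by exact_mod_cast Fintype.card_pos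
  set n : ℝ := (Fintype.card V : ℝ)
  have hsum : ∑ v, (1 + n * ω v / Ω) = 2 * n := by
    rw [Finset.sum_add_distrib, ← Finset.sum_div, ← Finset.mul_sum, ← hΩ,
      mul_div_cancel_right₀ _ hΩ0.ne']
    simp only [Finset.sum_const, Finset.card_univ, nsmul_eq_mul, mul_one]
    linarith
  have key : ∀ x y : ℝ, 0 < x → 1 + n * x / Ω ≤ y →
      Real.logb 2 (2 * n) - Real.logb 2 y ≤ Real.logb 2 Ω - Real.logb 2 x + 1 := by
    intro x y hx hy
    have h0 : 0 < n * x / Ω := by positivity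
    have h1 : Real.logb 2 (n * x / Ω) ≤ Real.logb 2 y :=
      Real.logb_le_logb_of_le (by norm_num) h0 (by linarith)
    rw [Real.logb_div (by positivity) hΩ0.ne', Real.logb_mul hn.ne' hx.ne'] at h1
    rw [Real.logb_mul (by norm_num) hn.ne', Real.logb_self_eq_one (by norm_num)]
    linarith
  obtain ⟨μ, κ, hl⟩ := h (fun v => 1 + n * ω v / Ω)
    (fun v => le_add_of_nonneg_right (by have := hω v; positivity)) hsum
  refine ⟨μ, κ, hl.injective, hl.adjacency, hl.identity, ?_, ?_, hl.length_local⟩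
  · intro v
    have h1 := hl.length_vertex v
    rw [hsum] at h1
    have h2 := key (ω v) _ (hω v) le_rfl
    linarith
  · intro K
    have h1 := hl.length_clique K
    rw [hsum] at h1
    have h2 := key (K.1.inf' K.2.1 ω) (K.1.inf' K.2.1 fun v => 1 + n * ω v / Ω)
      ((Finset.lt_inf'_iff _).2 fun v _ => hω v) (Finset.le_inf' _ _ fun v hv => by
        have := Finset.inf'_le ω hv
        gcongr)
    linarith

open Classical in
/-- The scheme for the tree closure, with explicit bounds: `M n = log (2 n)`, the width of the
levels is `σ n`, and `N n` bounds the lengths of all strings that are delimited. -/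
theorem GraphClass.AdmitsMixedScheme.treeClosure {𝒢 : GraphClass} (h𝒢 : 𝒢.Hereditary) (k : ℕ)
    {g₁ g₂ g₃ : ℕ → ℝ} (hg₂ : ∀ n, 0 < g₂ n) (hg₃ : ∀ n, 0 < g₃ n)
    (hm₁ : Monotone g₁) (hm₂ : Monotone g₂) (hm₃ : Monotone g₃)
    (h : 𝒢.AdmitsMixedScheme g₁ g₂ g₃) {M σ c : ℕ → ℝ} {N : ℕ → ℕ}
    (hM : ∀ n, M n = 1 + Real.logb 2 n) (hσ : ∀ n, 0 < σ n)
    (hN : ∀ n, M n + Real.logb 2 (k + 1) + g₃ n + (1 + Real.logb 2 (k + 1) + σ n) + g₂ n + k +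
      M n / σ n + 2 ≤ N n) (hc : ∀ n, c n = 6 * (N n).size + 4) :
    (𝒢.treeClosure k).AdmitsMixedScheme
      (fun n => g₁ n + (M n / σ n + 1) * (Real.logb 2 (k + 1) + g₃ n + c n) +
        Real.logb 2 (k + 1) + 5 + 2 * c n + (1 + Real.logb 2 (k + 1) + σ n) +
        k * (2 * c n + (1 + Real.logb 2 (k + 1) + σ n) + g₂ n) + 1)
      (fun n => 2 * c n + (1 + Real.logb 2 (k + 1) + σ n) + g₂ n + 1)
      (fun n => g₃ n + (M n / σ n + 1) * (Real.logb 2 (k + 1) + g₃ n + c n) +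
        Real.logb 2 (k + 1) + 4 + c n + k + 1) := by
  obtain ⟨A, I, h⟩ := h
  refine ⟨glueAdj A I, glueMem I, ?_⟩
  rintro V _ _ Gp G ω ⟨D, hDk, hD⟩ hG hω
  obtain ⟨F⟩ := D.nonempty_adhesionForest h𝒢 hDk hD
  set n := Fintype.card V with hn
  have hn0 : (0 : ℝ) < n := by exact_mod_cast Fintype.card_pos
  have hMn : Real.logb 2 (2 * n) = M n := by
    rw [hM, Real.logb_mul (by norm_num) hn0.ne', Real.logb_self_eq_one (by norm_num)]
  have hM0 : 0 ≤ M n := by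
    rw [← hMn]
    refine Real.logb_nonneg (by norm_num) ?_
    have : (1 : ℝ) ≤ n := by exact_mod_cast Nat.one_le_iff_ne_zero.2 Fintype.card_ne_zero
    linarith
  have hLk0 : 0 ≤ Real.logb 2 ((k : ℝ) + 1) :=
    Real.logb_nonneg (by norm_num) (by linarith [(Nat.cast_nonneg k : (0 : ℝ) ≤ k)])
  refine exists_labelling_of_normalized (fun ω hω1 hsum => ?_) hω
  obtain ⟨Λ, hΛ, hheads⟩ := F.exists_levelling hω1 (hσ n)
  have hloc : ∀ y, ∀ θ : {v // F.home v = y} → ℝ, (∀ v, 0 < θ v) → ∃ μ κ,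
      IsWeightedMixedLabelling A I (g₁ n) (g₂ n) (g₃ n) (F.torso y) (G.comap Subtype.val) θ μ κ := by
    intro y θ hθ
    obtain ⟨v, hv⟩ := F.home_surjective y
    have : Nonempty {v // F.home v = y} := ⟨⟨v, hv⟩⟩
    obtain ⟨μ, κ, hl⟩ := h _ (F.torso y) (G.comap Subtype.val) θ (F.torso_mem y)
      (fun u v huv => F.torso_of_adj y u v (hG huv)) hθ
    have hcard := Fintype.card_subtype_le fun v => F.home v = y
    exact ⟨μ, κ, hl.mono (hm₁ hcard) (hm₂ hcard) (hm₃ hcard)⟩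
  have hτ : Real.logb 2 (2 * ((k : ℝ) + 1) * 2 ^ σ n) = 1 + Real.logb 2 (k + 1) + σ n := by
    rw [Real.logb_mul (by positivity) (by positivity), Real.logb_mul (by norm_num) (by positivity),
      Real.logb_self_eq_one (by norm_num), Real.logb_rpow (by norm_num) (by norm_num)]
  rw [hsum, hMn] at hΛ
  have hℓ : ((⌊M n / σ n⌋₊ : ℕ) : ℝ) ≤ M n / σ n := Nat.floor_le (div_nonneg hM0 (hσ n).le)
  obtain ⟨μ, κ, hl⟩ := AdhesionForest.exists_glued_labelling (hg₂ n).le (hg₃ n).le hG Λ hloc hω1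
    (Real.one_le_rpow (by norm_num) (hσ n).le) hheads hΛ (N := N n) (by
      rw [hsum, hMn, hτ]
      have := hN n
      linarith)
  rw [hτ, ← hc] at hl
  have hc0 : 0 ≤ c n := by rw [hc]; positivity
  have hprod : ((⌊M n / σ n⌋₊ : ℕ) + 1 : ℝ) * (Real.logb 2 (k + 1) + g₃ n + c n) ≤
      (M n / σ n + 1) * (Real.logb 2 (k + 1) + g₃ n + c n) := by
    have := hg₃ n
    gcongr
  exact ⟨μ, κ, hl.mono (by linarith) le_rfl (by linarith)⟩

/-! ### Asymptotics -/

theorem tendsto_logb_natCast : Tendsto (fun n : ℕ => Real.logb 2 n) atTop atTop :=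
  (Real.tendsto_logb_atTop (by norm_num)).comp tendsto_natCast_atTop_atTop

theorem tendsto_logb_logb_natCast :
    Tendsto (fun n : ℕ => Real.logb 2 (Real.logb 2 n)) atTop atTop :=
  (Real.tendsto_logb_atTop (by norm_num)).comp tendsto_logb_natCast

theorem isBigO_const_of_tendsto_atTop {f : ℕ → ℝ} (hf : Tendsto f atTop atTop) (a : ℝ) :
    (fun _ : ℕ => a) =O[atTop] f :=
  (isLittleO_const_left.2 (Or.inr (tendsto_norm_atTop_atTop.comp hf))).isBigO

/-- Square roots of comparable functions are comparable. -/
theorem isBigO_of_sq_le {f g : ℕ → ℝ} {C : ℝ} (hC : 0 ≤ C)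
    (h : ∀ᶠ n in atTop, f n ^ 2 ≤ C * g n) : f =O[atTop] fun n => √(g n) := by
  refine IsBigO.of_bound √C (h.mono fun n hn => ?_)
  rw [Real.norm_eq_abs, Real.norm_of_nonneg (Real.sqrt_nonneg _), ← Real.sqrt_mul hC]
  exact Real.abs_le_sqrt hn

/-- The size of a number of order `log n` is of order `log log n`. -/
theorem isBigO_size {N : ℕ → ℕ} (hN : (fun n => (N n : ℝ)) =O[atTop] fun n : ℕ => Real.logb 2 n) :
    (fun n => ((N n).size : ℝ)) =O[atTop] fun n : ℕ => Real.logb 2 (Real.logb 2 n) := by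
  obtain ⟨C, hC0, hC⟩ := hN.exists_pos
  have hsize : ∀ m : ℕ, 0 < m → (m.size : ℝ) ≤ Real.logb 2 m + 1 := by
    intro m hm
    obtain ⟨j, hj⟩ := Nat.exists_eq_succ_of_ne_zero (Nat.size_pos.2 hm).ne'
    have h1 : 2 ^ j ≤ m := Nat.lt_size.1 (by omega)
    have h2 : (j : ℝ) ≤ Real.logb 2 m := by
      rw [Real.le_logb_iff_rpow_le (by norm_num) (by exact_mod_cast hm), Real.rpow_natCast]
      exact_mod_cast h1
    rw [hj]
    push_cast
    linarith
  have key : (fun n => ((N n).size : ℝ)) =O[atTop]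
      fun n : ℕ => |Real.logb 2 C + 1| + Real.logb 2 (Real.logb 2 n) := by
    refine IsBigO.of_bound 1 ?_
    filter_upwards [hC.bound, tendsto_logb_natCast.eventually_ge_atTop 1] with n hn h1
    have hLL : 0 ≤ Real.logb 2 (Real.logb 2 n) := Real.logb_nonneg (by norm_num) h1
    rw [Real.norm_of_nonneg (Nat.cast_nonneg _), one_mul,
      Real.norm_of_nonneg (add_nonneg (abs_nonneg _) hLL)]
    rcases Nat.eq_zero_or_pos (N n) with h0 | h0
    · rw [h0]
      simpa using add_nonneg (abs_nonneg _) hLL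
    · have h0' : (0 : ℝ) < N n := by exact_mod_cast h0
      rw [Real.norm_of_nonneg h0'.le, Real.norm_of_nonneg (by linarith)] at hn
      have h2 := Real.logb_le_logb_of_le (b := 2) (by norm_num) h0' hn
      rw [Real.logb_mul hC0.ne' (by linarith)] at h2
      have h3 := hsize _ h0
      have h4 := le_abs_self (Real.logb 2 C + 1)
      linarith
  exact key.trans ((isBigO_const_of_tendsto_atTop tendsto_logb_logb_natCast _).add
    (isBigO_refl _ _))

/-- The quantitative form, without any assumption on disjoint unions. -/
theorem GraphClass.exists_treeClosure_scheme {𝒢 : GraphClass} (h𝒢 : 𝒢.Hereditary) (k : ℕ)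
    {g₁ g₂ g₃ : ℕ → ℝ} (hg₁ : ∀ n, 0 < g₁ n) (hg₂ : ∀ n, 0 < g₂ n) (hg₃ : ∀ n, 0 < g₃ n)
    (hm₁ : Monotone g₁) (hm₂ : Monotone g₂) (hm₃ : Monotone g₃)
    (hO₂ : g₂ =O[atTop] fun n : ℕ => Real.logb 2 n)
    (hO₃ : g₃ =O[atTop] fun n : ℕ => Real.logb 2 n) (h : 𝒢.AdmitsMixedScheme g₁ g₂ g₃) :
    ∃ g₁'' g₂'' g₃'' : ℕ → ℝ,
      (∀ n, 0 < g₁'' n) ∧ (∀ n, 0 < g₂'' n) ∧ (∀ n, 0 < g₃'' n) ∧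
      (𝒢.treeClosure k).AdmitsMixedScheme g₁'' g₂'' g₃'' ∧
      (∃ e₁ e₂ e₃ : ℕ → ℝ,
        (e₁ =O[atTop] g₂) ∧
        (e₂ =O[atTop] fun n : ℕ => √(g₃ n * Real.logb 2 n)) ∧
        (e₃ =O[atTop] fun n : ℕ =>
          √(Real.logb 2 n / g₃ n) * Real.logb 2 (Real.logb 2 n)) ∧
        ∀ n, g₁'' n = g₁ n + e₁ n + e₂ n + e₃ n) ∧
      (∃ e₁ e₂ : ℕ → ℝ,
        (e₁ =O[atTop] fun n : ℕ => √(g₃ n * Real.logb 2 n)) ∧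
        (e₂ =O[atTop] fun n : ℕ => Real.logb 2 (Real.logb 2 n)) ∧
        ∀ n, g₂'' n = g₂ n + e₁ n + e₂ n) ∧
      (∃ e₁ e₂ : ℕ → ℝ,
        (e₁ =O[atTop] fun n : ℕ => √(g₃ n * Real.logb 2 n)) ∧
        (e₂ =O[atTop] fun n : ℕ =>
          √(Real.logb 2 n / g₃ n) * Real.logb 2 (Real.logb 2 n)) ∧
        ∀ n, g₃'' n = e₁ n + e₂ n) := by
  obtain ⟨M, hM⟩ : ∃ M : ℕ → ℝ, ∀ n : ℕ, M n = 1 + Real.logb 2 n := ⟨_, fun _ => rfl⟩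
  have hM0 : ∀ n, 0 < M n := by
    intro n
    rw [hM]
    rcases Nat.eq_zero_or_pos n with rfl | hn
    · simp
    · have : 0 ≤ Real.logb 2 n := Real.logb_nonneg (by norm_num) (by exact_mod_cast hn)
      linarith
  obtain ⟨σ, hσ⟩ : ∃ σ : ℕ → ℝ, ∀ n, σ n = √(g₃ n * M n) := ⟨_, fun _ => rfl⟩
  have hσ0 : ∀ n, 0 < σ n := fun n => by
    rw [hσ]; exact Real.sqrt_pos.2 (mul_pos (hg₃ n) (hM0 n))
  have hσsq : ∀ n, σ n ^ 2 = g₃ n * M n := fun n => by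
    rw [hσ]; exact Real.sq_sqrt (mul_pos (hg₃ n) (hM0 n)).le
  set Lk := Real.logb 2 ((k : ℝ) + 1) with hLk
  have hk0 : (0 : ℝ) ≤ k := Nat.cast_nonneg k
  have hLk0 : 0 ≤ Lk := Real.logb_nonneg (by norm_num) (by linarith)
  obtain ⟨N, hN⟩ : ∃ N : ℕ → ℕ, ∀ n, N n = ⌈M n + Lk + g₃ n + (1 + Lk + σ n) + g₂ n + k +
      M n / σ n + 2⌉₊ := ⟨_, fun _ => rfl⟩
  obtain ⟨c, hc⟩ : ∃ c : ℕ → ℝ, ∀ n, c n = 6 * (N n).size + 4 := ⟨_, fun _ => rfl⟩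
  have hc0 : ∀ n, 0 < c n := fun n => by rw [hc]; positivity
  -- the choice of `σ` balances the two kinds of overhead
  have hbal : ∀ n, M n / σ n * g₃ n = σ n := by
    intro n
    rw [div_mul_eq_mul_div, div_eq_iff (hσ0 n).ne', ← sq, hσsq, mul_comm]
  have hL1 := tendsto_logb_natCast.eventually_ge_atTop 1
  have hconstL : ∀ a : ℝ, (fun _ : ℕ => a) =O[atTop] fun n : ℕ => Real.logb 2 n :=
    isBigO_const_of_tendsto_atTop tendsto_logb_natCast
  have hconstLL : ∀ a : ℝ, (fun _ : ℕ => a) =O[atTop] fun n : ℕ => Real.logb 2 (Real.logb 2 n) :=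
    isBigO_const_of_tendsto_atTop tendsto_logb_logb_natCast
  have hML : M =O[atTop] fun n : ℕ => Real.logb 2 n :=
    ((hconstL 1).add (isBigO_refl _ _)).congr_left fun n => (hM n).symm
  obtain ⟨C, hC0, hC⟩ := hO₃.exists_pos
  have hg₃L : ∀ᶠ n : ℕ in atTop, g₃ n ≤ C * Real.logb 2 n := by
    filter_upwards [hC.bound, hL1] with n hn h1
    rwa [Real.norm_of_nonneg (hg₃ n).le, Real.norm_of_nonneg (by linarith)] at hn
  have hσO : σ =O[atTop] fun n : ℕ => √(g₃ n * Real.logb 2 n) := by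
    refine isBigO_of_sq_le (C := 2) (by norm_num) ?_
    filter_upwards [hL1] with n h1
    rw [hσsq, hM]
    nlinarith [hg₃ n]
  have hg₃O : g₃ =O[atTop] fun n : ℕ => √(g₃ n * Real.logb 2 n) := by
    refine isBigO_of_sq_le hC0.le ?_
    filter_upwards [hg₃L] with n h1
    nlinarith [hg₃ n]
  have hdO : (fun n => M n / σ n) =O[atTop] fun n : ℕ => √(Real.logb 2 n / g₃ n) := by
    refine isBigO_of_sq_le (C := 2) (by norm_num) ?_
    filter_upwards [hL1] with n h1
    have h2 := hM0 n
    rw [div_pow, hσsq, sq, mul_div_mul_right _ _ h2.ne', hM, mul_div_assoc', div_le_div_iff_of_pos_right (hg₃ n)]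
    linarith
  have h1O : (fun _ : ℕ => (1 : ℝ)) =O[atTop] fun n : ℕ => √(Real.logb 2 n / g₃ n) := by
    refine isBigO_of_sq_le hC0.le ?_
    filter_upwards [hg₃L] with n h1
    rw [mul_div_assoc', le_div_iff₀ (hg₃ n)]
    linarith
  have hdL : (fun n => M n / σ n) =O[atTop] fun n : ℕ => Real.logb 2 n := by
    refine hdO.trans (IsBigO.of_bound √(g₃ 0)⁻¹ ?_)
    filter_upwards [hL1] with n h1
    rw [Real.norm_of_nonneg (Real.sqrt_nonneg _), Real.norm_of_nonneg (by linarith),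
      div_eq_mul_inv, mul_comm, Real.sqrt_mul (inv_nonneg.2 (hg₃ n).le)]
    have h2 : √(Real.logb 2 n) ≤ Real.logb 2 n := by
      rw [Real.sqrt_le_left (by linarith)]
      nlinarith
    have h3 : √(g₃ n)⁻¹ ≤ √(g₃ 0)⁻¹ :=
      Real.sqrt_le_sqrt (inv_anti₀ (hg₃ 0) (hm₃ (Nat.zero_le n)))
    gcongr
  have hσL : σ =O[atTop] fun n : ℕ => Real.logb 2 n := by
    refine hσO.trans (IsBigO.of_bound √C ?_)
    filter_upwards [hL1, hg₃L] with n h1 h2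
    rw [Real.norm_of_nonneg (Real.sqrt_nonneg _), Real.norm_of_nonneg (by linarith)]
    refine Real.sqrt_le_iff.2 ⟨by positivity, ?_⟩
    rw [mul_pow, Real.sq_sqrt hC0.le]
    nlinarith
  have hNL : (fun n => (N n : ℝ)) =O[atTop] fun n : ℕ => Real.logb 2 n := by
    have h1 : (fun n => M n + Lk + g₃ n + (1 + Lk + σ n) + g₂ n + k + M n / σ n + 2 + 1) =O[atTop]
        fun n : ℕ => Real.logb 2 n :=
      ((((((((hML.add (hconstL _)).add hO₃).add ((hconstL _).add hσL)).add hO₂).add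
        (hconstL _)).add hdL).add (hconstL _)).add (hconstL _))
    refine (IsBigO.of_bound 1 (Eventually.of_forall fun n => ?_)).trans h1
    have h2 : 0 ≤ M n + Lk + g₃ n + (1 + Lk + σ n) + g₂ n + k + M n / σ n + 2 := by
      have := hM0 n; have := hg₃ n; have := hg₂ n; have := hσ0 n
      positivity
    rw [Real.norm_of_nonneg (Nat.cast_nonneg _), one_mul, Real.norm_of_nonneg (by linarith), hN]
    exact (Nat.ceil_lt_add_one h2).le
  have hcLL : c =O[atTop] fun n : ℕ => Real.logb 2 (Real.logb 2 n) :=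
    (((isBigO_size hNL).const_mul_left 6).add (hconstLL 4)).congr_left fun n => (hc n).symm
  have hLLO : (fun n : ℕ => Real.logb 2 (Real.logb 2 n)) =O[atTop]
      fun n : ℕ => √(Real.logb 2 n / g₃ n) * Real.logb 2 (Real.logb 2 n) :=
    (h1O.mul (isBigO_refl _ _)).congr_left fun n => one_mul _
  have hdcO : (fun n => (M n / σ n + 1) * (Lk + c n)) =O[atTop]
      fun n : ℕ => √(Real.logb 2 n / g₃ n) * Real.logb 2 (Real.logb 2 n) :=
    (hdO.add h1O).mul ((hconstLL _).add hcLL)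
  refine ⟨_, _, _, ?_, ?_, ?_, h.treeClosure h𝒢 k hg₂ hg₃ hm₁ hm₂ hm₃ hM hσ0
    (fun n => by rw [hN]; exact Nat.le_ceil _) hc, ?_, ?_, ?_⟩
  · intro n
    have := hM0 n; have := hg₁ n; have := hg₂ n; have := hg₃ n; have := hσ0 n; have := hc0 n
    positivity
  · intro n
    have := hg₂ n; have := hσ0 n; have := hc0 n
    positivity
  · intro n
    have := hM0 n; have := hg₃ n; have := hσ0 n; have := hc0 n
    positivity
  · refine ⟨fun n => k * g₂ n, fun n => (k + 2) * σ n + g₃ n,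
      fun n => (M n / σ n + 1) * (Lk + c n) +
        ((2 + 2 * k) * c n + (7 + 2 * Lk + k * (1 + Lk))), (isBigO_refl _ _).const_mul_left _,
      (hσO.const_mul_left _).add hg₃O,
      hdcO.add (((hcLL.const_mul_left _).add (hconstLL _)).trans hLLO), fun n => ?_⟩
    linear_combination hbal n
  · refine ⟨σ, fun n => 2 * c n + (2 + Lk), hσO, (hcLL.const_mul_left _).add (hconstLL _),
      fun n => by ring⟩
  · refine ⟨fun n => σ n + 2 * g₃ n, fun n => (M n / σ n + 1) * (Lk + c n) +
      (c n + (5 + Lk + k)), hσO.add (hg₃O.const_mul_left _),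
      hdcO.add ((hcLL.add (hconstLL _)).trans hLLO), fun n => ?_⟩
    linear_combination hbal n

/-- A function of order `o(log n)` has a non-decreasing majorant of the same order that is at
least `1`. -/
theorem exists_monotone_majorant {g : ℕ → ℝ} (hg : g =o[atTop] fun n : ℕ => Real.logb 2 n) :
    ∃ f : ℕ → ℝ, g ≤ f ∧ Monotone f ∧ (∀ n, 1 ≤ f n) ∧
      f =o[atTop] fun n : ℕ => Real.logb 2 n := by
  refine ⟨partialSups fun n => max (g n) 1, ?_, partialSups_monotone _, ?_, ?_⟩
  · intro n
    exact (le_max_left _ _).trans (le_partialSups (fun n => max (g n) 1) n)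
  · intro n
    exact (le_max_right (g n) 1).trans (le_partialSups (fun n => max (g n) 1) n)
  · rw [isLittleO_iff]
    intro ε hε
    have h1 := (isLittleO_iff.1 hg) hε
    have h2 := tendsto_logb_natCast.eventually_ge_atTop (1 / ε)
    obtain ⟨m, hm⟩ := eventually_atTop.1 (h1.and h2)
    have h3 := tendsto_logb_natCast.eventually_ge_atTop
      ((partialSups (fun n => max (g n) 1) m) / ε)
    filter_upwards [h3, eventually_ge_atTop m, h2] with n hn hmn hn2
    have h0 : ∀ n, 1 ≤ partialSups (fun n => max (g n) 1) n := fun n =>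
      (le_max_right (g n) 1).trans (le_partialSups (fun n => max (g n) 1) n)
    have hlog : 0 < Real.logb 2 n := lt_of_lt_of_le (by positivity) hn2
    rw [Real.norm_of_nonneg (zero_le_one.trans (h0 n)), Real.norm_of_nonneg hlog.le]
    refine partialSups_le _ n _ fun i hi => ?_
    rcases le_total i m with him | him
    · rw [div_le_iff₀ hε] at hn
      have := le_partialSups_of_le (fun n => max (g n) 1) him
      linarith
    · obtain ⟨h4, h5⟩ := hm i him
      have hi0 : 0 < Real.logb 2 i := lt_of_lt_of_le (by positivity) h5
      rw [Real.norm_of_nonneg hi0.le] at h4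
      rw [div_le_iff₀ hε] at h5
      have h6 : (0 : ℝ) < i := by
        by_contra hc
        have : i = 0 := by exact_mod_cast le_antisymm (not_lt.1 hc) (Nat.cast_nonneg i)
        simp [this] at hi0
      have h7 : Real.logb 2 i ≤ Real.logb 2 n :=
        Real.logb_le_logb_of_le (by norm_num) h6 (by exact_mod_cast hi)
      have h8 : ε * Real.logb 2 i ≤ ε * Real.logb 2 n := by gcongr
      exact max_le ((le_abs_self _).trans (h4.trans h8)) (by linarith)

theorem isLittleO_sqrt_mul_log {g : ℕ → ℝ} (h0 : ∀ n, 0 ≤ g n)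
    (hg : g =o[atTop] fun n : ℕ => Real.logb 2 n) :
    (fun n : ℕ => √(g n * Real.logb 2 n)) =o[atTop] fun n : ℕ => Real.logb 2 n := by
  rw [isLittleO_iff]
  intro ε hε
  have h1 := (isLittleO_iff.1 hg) (sq_pos_of_pos hε)
  filter_upwards [h1, tendsto_logb_natCast.eventually_ge_atTop 1] with n hn h2
  rw [Real.norm_of_nonneg (h0 n), Real.norm_of_nonneg (by linarith)] at hn
  rw [Real.norm_of_nonneg (Real.sqrt_nonneg _), Real.norm_of_nonneg (by linarith)]
  refine Real.sqrt_le_iff.2 ⟨by positivity, ?_⟩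
  nlinarith

theorem isLittleO_sqrt_log_div_mul {g : ℕ → ℝ} (h1 : ∀ n, 1 ≤ g n) :
    (fun n : ℕ => √(Real.logb 2 n / g n) * Real.logb 2 (Real.logb 2 n)) =o[atTop]
      fun n : ℕ => Real.logb 2 n := by
  have h2 : (fun x : ℝ => Real.logb 2 x) =o[atTop] fun x : ℝ => x ^ (1 / 2 : ℝ) := by
    have := (isLittleO_log_rpow_atTop (r := 1 / 2) (by norm_num)).const_mul_left (Real.log 2)⁻¹
    refine this.congr_left fun x => ?_
    rw [Real.logb, div_eq_inv_mul]
  have h3 := h2.comp_tendsto tendsto_logb_natCast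
  have h4 : (fun n : ℕ => √(Real.logb 2 n / g n)) =O[atTop]
      fun n : ℕ => (Real.logb 2 n) ^ (1 / 2 : ℝ) := by
    refine IsBigO.of_bound 1 ?_
    filter_upwards [tendsto_logb_natCast.eventually_ge_atTop 1] with n hn
    rw [← Real.sqrt_eq_rpow, one_mul, Real.norm_of_nonneg (Real.sqrt_nonneg _),
      Real.norm_of_nonneg (Real.sqrt_nonneg _)]
    exact Real.sqrt_le_sqrt (div_le_self (by linarith) (h1 n))
  refine (h4.mul_isLittleO h3).congr' EventuallyEq.rfl ?_
  filter_upwards [tendsto_logb_natCast.eventually_ge_atTop 1] with n hn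
  simp only [Function.comp]
  rw [← Real.sqrt_eq_rpow, Real.mul_self_sqrt (by linarith)]

theorem mainTheorem3 :
    -- qualitative form
    (∀ 𝒢 : GraphClass, 𝒢.Hereditary → 𝒢.AdmitsEfficientMixedScheme →
      ∀ k : ℕ, (𝒢.treeClosure k).AdmitsEfficientMixedScheme) ∧
    -- quantitative form
    (∀ 𝒢 : GraphClass, 𝒢.Hereditary → 𝒢.ClosedUnderDisjointUnion →
      ∀ (k : ℕ) (g₁ g₂ g₃ : ℕ → ℝ),
        (∀ n, 0 < g₁ n) → (∀ n, 0 < g₂ n) → (∀ n, 0 < g₃ n) →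
        Monotone g₁ → Monotone g₂ → Monotone g₃ →
        (g₁ =O[atTop] fun n : ℕ => Real.logb 2 n) →
        (g₂ =O[atTop] fun n : ℕ => Real.logb 2 n) →
        (g₃ =O[atTop] fun n : ℕ => Real.logb 2 n) →
        𝒢.AdmitsMixedScheme g₁ g₂ g₃ →
        ∃ g₁'' g₂'' g₃'' : ℕ → ℝ,
          (∀ n, 0 < g₁'' n) ∧ (∀ n, 0 < g₂'' n) ∧ (∀ n, 0 < g₃'' n) ∧
          (𝒢.treeClosure k).AdmitsMixedScheme g₁'' g₂'' g₃'' ∧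
          (∃ e₁ e₂ e₃ : ℕ → ℝ,
            (e₁ =O[atTop] g₂) ∧
            (e₂ =O[atTop] fun n : ℕ => √(g₃ n * Real.logb 2 n)) ∧
            (e₃ =O[atTop] fun n : ℕ =>
              √(Real.logb 2 n / g₃ n) * Real.logb 2 (Real.logb 2 n)) ∧
            ∀ n, g₁'' n = g₁ n + e₁ n + e₂ n + e₃ n) ∧
          (∃ e₁ e₂ : ℕ → ℝ,
            (e₁ =O[atTop] fun n : ℕ => √(g₃ n * Real.logb 2 n)) ∧
            (e₂ =O[atTop] fun n : ℕ => Real.logb 2 (Real.logb 2 n)) ∧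
            ∀ n, g₂'' n = g₂ n + e₁ n + e₂ n) ∧
          (∃ e₁ e₂ : ℕ → ℝ,
            (e₁ =O[atTop] fun n : ℕ => √(g₃ n * Real.logb 2 n)) ∧
            (e₂ =O[atTop] fun n : ℕ =>
              √(Real.logb 2 n / g₃ n) * Real.logb 2 (Real.logb 2 n)) ∧
            ∀ n, g₃'' n = e₁ n + e₂ n)) := by
  constructor
  · intro 𝒢 h𝒢 h k
    obtain ⟨g₁, g₂, g₃, -, -, -, h₁, h₂, h₃, h⟩ := h
    obtain ⟨f₁, hl₁, hm₁, h1₁, ho₁⟩ := exists_monotone_majorant h₁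
    obtain ⟨f₂, hl₂, hm₂, h1₂, ho₂⟩ := exists_monotone_majorant h₂
    obtain ⟨f₃, hl₃, hm₃, h1₃, ho₃⟩ := exists_monotone_majorant h₃
    have hsq := isLittleO_sqrt_mul_log (fun n => zero_le_one.trans (h1₃ n)) ho₃
    have hdiv := isLittleO_sqrt_log_div_mul h1₃
    have hLL : (fun n : ℕ => Real.logb 2 (Real.logb 2 n)) =o[atTop]
        fun n : ℕ => Real.logb 2 n := by
      refine IsBigO.trans_isLittleO ?_ (isLittleO_sqrt_log_div_mul (g := fun _ => 1) fun _ => le_rfl)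
      refine IsBigO.of_bound 1 ?_
      filter_upwards [tendsto_logb_natCast.eventually_ge_atTop 1] with n hn
      rw [norm_mul, one_mul, div_one, Real.norm_of_nonneg (Real.sqrt_nonneg _)]
      exact le_mul_of_one_le_left (norm_nonneg _) (Real.one_le_sqrt.2 hn)
    obtain ⟨g₁', g₂', g₃', hp₁, hp₂, hp₃, hs, ⟨a₁, a₂, a₃, ha₁, ha₂, ha₃, ha⟩,
      ⟨b₁, b₂, hb₁, hb₂, hb⟩, ⟨c₁, c₂, hc₁, hc₂, hc⟩⟩ :=
      GraphClass.exists_treeClosure_scheme h𝒢 k (fun n => one_pos.trans_le (h1₁ n))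
        (fun n => one_pos.trans_le (h1₂ n)) (fun n => one_pos.trans_le (h1₃ n)) hm₁ hm₂ hm₃
        ho₂.isBigO ho₃.isBigO (h.mono hl₁ hl₂ hl₃)
    refine ⟨g₁', g₂', g₃', hp₁, hp₂, hp₃, ?_, ?_, ?_, hs⟩
    · exact (((ho₁.add (ha₁.trans_isLittleO ho₂)).add (ha₂.trans_isLittleO hsq)).add
        (ha₃.trans_isLittleO hdiv)).congr_left fun n => (ha n).symm
    · exact ((ho₂.add (hb₁.trans_isLittleO hsq)).add
        (hb₂.trans_isLittleO hLL)).congr_left fun n => (hb n).symm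
    · exact ((hc₁.trans_isLittleO hsq).add (hc₂.trans_isLittleO hdiv)).congr_left
        fun n => (hc n).symm
  · intro 𝒢 h𝒢 _ k g₁ g₂ g₃ hg₁ hg₂ hg₃ hm₁ hm₂ hm₃ _ hO₂ hO₃ h
    exact GraphClass.exists_treeClosure_scheme h𝒢 k hg₁ hg₂ hg₃ hm₁ hm₂ hm₃ hO₂ hO₃ h
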